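/- Let $\lambda$ be a partition with conjugate $\lambda'$, let $L=\lambda_1$, and let $n\ge \ell(\lambda)$. A *multiline queue* of shape $\lambda$ is a tuple $M=(B_1,\dots,B_L)$ of subsets of $[n]=\{1,\dots,n\}$ with $|B_r|=\lambda'_r$; the elements of $B_r$ are the columns of the balls in row $r$ of an $L\times n$ array, rows being numbered from bottom to top. Let $\mathrm{MLQ}_\lambda$ be the set of these. *Type.* For $r=L,L-1,\dots,2$: label every unlabeled ball of row $r$ by $r$; then, from the largest label to the smallest and from left to right among equal labels, pair each ball of row $r$ with the first unlabeled ball weakly to its right in row $r-1$ (wrapping around from column $n$ to column $1$), which acquires its label. Finally label the unlabeled balls of row $1$ by $1$. Then $\mathrm{type}(M)\in\mathbb{Z}_{\ge0}^n$ is the sequence of labels of row $1$, with $0$ at the empty sites. (Arrays with $L$ rows and arbitrary row sets are treated in the same way.) *Operators.* For a word $w$ and an index $i$, read each letter $i$ as ")" and each $i+1$ as "(", and match parentheses as usual. The row word of $M$ lists the column numbers of its balls, rows from top to bottom, each row from right to left; the column word lists the row numbers, columns from left to right, each column from top to bottom. For $1\le i<n$, $f_i^{\to}$ moves the ball of the rightmost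 unmatched $i$ in the row word from column $i$ to column $i+1$ (and fixes $M$ if there is none). For $1\le i<L$, $e_i^{\downarrow\star}$ moves the balls of all unmatched letters $i+1$ in the column word from row $i+1$ to row $i$. The crystal graph on $\mathrm{MLQ}_\lambda$ has an edge $M\to M'$ whenever $M'=f_i^{\to}(M)$ for some $1\le i<n$; its connected components are those of the underlying undirected graph. *Collapsing.* Put $M_1=M$ and $M_{i+1}=e_1^{\downarrow\star}e_2^{\downarrow\star}\cdots e_i^{\downarrow\star}(M_i)$ (rightmost operator first) for $1\le i<L$; the collapse is $\rho(M)=M_L$ (and $\rho(M)=M$ if $L=0$). The recording tableau $\rho_Q(M)$ starts as one row of $|B_1|$ boxes with entry $1$; in the step from $M_i$ to $M_{i+1}$ one adds boxes with entry $i+1$: to each row $j\le i$ as many as row $j$ of $M_{i+1}$ has more balls than row $j$ of $M_i$, and to row $i+1$ as many as row $i+1$ of $M_{i+1}$ has balls. **Theorem.** Let $M,M'\in\mathrm{MLQ}_\lambda$. Then $M$ and $M'$ lie in the same connected component of the crystal graph if and only if $\rho_Q(M)=\rho_Q(M')$. If this is the case and $\mathrm{type}(\rho(M))=\mathrm{type}(\rho(M'))$,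 then $\mathrm{type}(M)=\mathrm{type}(M')$. -/

import Mathlib

namespace MultilineQueue

/-- A generalized multiline queue, given by its set of balls: `(r, c) ∈ M` means that there is a
ball at the site in row `r` (rows are numbered `1, 2, …` from bottom to top) and column `c`
(columns are numbered `1, 2, …` from left to right). -/
abbrev Config : Type := Finset (ℕ × ℕ)

/-- The number of balls in row `r`. -/
def rowCard (M : Config) (r : ℕ) : ℕ := (M.filter fun s => s.1 = r).card

/-- The largest part `L = λ₁` of a partition, that is, the number of rows of a multiline queue of
shape `λ`. -/
def height (lam : YoungDiagram) : ℕ := lam.rowLen 0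

/-- The multiline queues of shape `(λ, n)`: arrangements of balls on the `λ₁ × n` array such that
row `j` contains `λ'_j` balls, for `1 ≤ j ≤ λ₁`. Mathlib numbers the columns of a Young diagram
from `0`, so that `λ'_{r + 1}` is `lam.colLen r`. -/
def MLQ (lam : YoungDiagram) (n : ℕ) : Type :=
  {M : Config // M ⊆ Finset.Icc 1 (height lam) ×ˢ Finset.Icc 1 n ∧
    ∀ r < height lam, rowCard M (r + 1) = lam.colLen r}

/-! ### The Ferrari–Martin algorithm -/

/-- The columns `c, c + 1, …, n, 1, …, c - 1`, in this order. -/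
def cyclicFrom (n c : ℕ) : List ℕ := List.range' c (n + 1 - c) ++ List.range' 1 (c - 1)

/-- The order in which the balls of a row with labels `lab` (`0` for an empty site) are paired:
from the largest label `L` to the smallest, and from left to right among equal labels. -/
def pairingOrder (L n : ℕ) (lab : ℕ → ℕ) : List ℕ :=
  (List.range' 1 L).reverse.flatMap fun l => (List.range' 1 n).filter fun c => lab c = l

/-- One pairing: the ball in column `c` of the row above, whose label is `a`, is paired to the
first unlabeled ball weakly to its right (cyclically) in row `r`, which acquires the label `a`.
Here `cur` holds the labels given so far in row `r`, with `0` at the sites without label. -/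
def pairOne (n : ℕ) (M : Config) (r c a : ℕ) (cur : ℕ → ℕ) : ℕ → ℕ :=
  match (cyclicFrom n c).find? fun d => (r, d) ∈ M ∧ cur d = 0 with
  | some d => Function.update cur d a
  | none => cur

/-- The labels that the balls of row `r` acquire from the balls of the row above, whose labels are
`lab`. -/
def acquired (L n : ℕ) (M : Config) (r : ℕ) (lab : ℕ → ℕ) : ℕ → ℕ :=
  (pairingOrder L n lab).foldl (fun cur c => pairOne n M r c (lab c) cur) fun _ => 0

/-- The labels of row `r`, from the labels `lab` of the row above: the balls that stay unpaired
get the label `r`; empty sites have the label `0`. -/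
def labelRow (L n : ℕ) (M : Config) (r : ℕ) (lab : ℕ → ℕ) (c : ℕ) : ℕ :=
  if (r, c) ∈ M then
    if acquired L n M r lab c = 0 then r else acquired L n M r lab c
  else 0

/-- `labelsFromTop L n M t` is the row of labels of row `L + 1 - t`; for `t = 0` this is the empty
row above the array. -/
def labelsFromTop (L n : ℕ) (M : Config) : ℕ → ℕ → ℕ
  | 0 => fun _ => 0
  | t + 1 => labelRow L n M (L - t) (labelsFromTop L n M t)

/-- The type of an `L × n` configuration: the composition formed by the labels of row `1`, with
`0` for an empty site. -/
def type (L n : ℕ) (M : Config) : Fin n → ℕ := fun c => labelsFromTop L n M L (c + 1)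

/-! ### Words, bracketing and crystal operators -/

/-- The balls of `M`, rows from top to bottom, each row from right to left. The row word of `M` is
the word of their column numbers. -/
def rowReading (L n : ℕ) (M : Config) : List (ℕ × ℕ) :=
  ((List.range' 1 L).reverse.flatMap fun r => (List.range' 1 n).reverse.map fun c => (r, c)).filter
    fun s => s ∈ M

/-- The balls of `M`, columns from left to right, each column from top to bottom. The column word
of `M` is the word of their row numbers. -/
def colReading (L n : ℕ) (M : Config) : List (ℕ × ℕ) :=
  ((List.range' 1 n).flatMap fun c => (List.range' 1 L).reverse.map fun r => (r, c)).filter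
    fun s => s ∈ M

/-- One step of the bracketing rule, scanning a word from left to right, where the letter at `x`
is `key x`. A letter `i` is a closing and a letter `i + 1` an opening parenthesis. The state
`(cl, op)` consists of the so far unmatched closing and opening ones, the most recent one first. -/
def bracketStep {α : Type} (key : α → ℕ) (i : ℕ) (st : List α × List α) (x : α) :
    List α × List α :=
  if key x = i then
    match st.2 with
    | [] => (x :: st.1, [])
    | _ :: op => (st.1, op)
  else if key x = i + 1 then (st.1, x :: st.2)
  else st

/-- The unmatched `i`s (first component) and the unmatched `i + 1`s (second component) of a word,
each listed from right to left. -/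
def unmatched {α : Type} (key : α → ℕ) (i : ℕ) (w : List α) : List α × List α :=
  w.foldl (bracketStep key i) ([], [])

/-- The column operator `f_i`: the ball of the rightmost unmatched `i` in the row word moves from
column `i` to column `i + 1`. -/
def fRight (L n i : ℕ) (M : Config) : Config :=
  match (unmatched Prod.snd i (rowReading L n M)).1.head? with
  | some s => insert (s.1, i + 1) (M.erase s)
  | none => M

/-- The row dropping operator `e_i`: the ball of the leftmost unmatched `i + 1` in the column word
moves from row `i + 1` to row `i`. -/
def eDown (L n i : ℕ) (M : Config) : Config :=
  match (unmatched Prod.fst i (colReading L n M)).2.getLast? with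
  | some s => insert (i, s.2) (M.erase s)
  | none => M

/-- Apply the dropping operator `e_i` until it acts trivially. (A nontrivial application removes a
ball from row `i + 1`, so there are at most `M.card` of them.) -/
def eDownStar (L n i : ℕ) (M : Config) : Config := (eDown L n i)^[M.card] M

/-- The composition of the starred dropping operators with index `i, i - 1, …, 1`, where the one
with index `i` is applied first. -/
def sweep (L n : ℕ) : ℕ → Config → Config
  | 0, M => M
  | i + 1, M => sweep L n i (eDownStar L n (i + 1) M)

/-! ### Collapsing -/

/-- `stage L n M k` is the configuration `M_{k + 1}` of the collapsing procedure. -/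
def stage (L n : ℕ) (M : Config) : ℕ → Config
  | 0 => M
  | k + 1 => sweep L n (k + 1) (stage L n M k)

/-- The collapse `ρ_N(M) = M_L`. -/
def collapse (L n : ℕ) (M : Config) : Config := stage L n M (L - 1)

/-- `recordingStage L n M k` is the tableau `Q_{k + 1}` of the collapsing procedure, given by its
rows: the value at `j` is the list of the entries of row `j`, from left to right. -/
def recordingStage (L n : ℕ) (M : Config) : ℕ → ℕ → List ℕ
  | 0 => fun j => if j = 1 then List.replicate (rowCard M 1) 1 else []
  | k + 1 => fun j =>
      if 1 ≤ j ∧ j < k + 2 then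
        recordingStage L n M k j ++
          List.replicate (rowCard (stage L n M (k + 1)) j - rowCard (stage L n M k) j) (k + 2)
      else if j = k + 2 then List.replicate (rowCard (stage L n M (k + 1)) j) (k + 2)
      else []

/-- The recording tableau `ρ_Q(M) = Q_L`, given by its rows. -/
def recording (L n : ℕ) (M : Config) : ℕ → List ℕ := recordingStage L n M (L - 1)

/-! ### The crystal graph -/

namespace MLQ

variable {lam : YoungDiagram} {n : ℕ}

/-- The directed edges of the crystal graph on the multiline queues of shape `(λ, n)`. -/
def Edge (M M' : MLQ lam n) : Prop :=
  ∃ i, 1 ≤ i ∧ i < n ∧ fRight (height lam) n i M.1 = M'.1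

/-- `M` and `M'` are in the same connected component of the crystal graph; edges may be traversed
in both directions. -/
def SameComponent (M M' : MLQ lam n) : Prop := Relation.EqvGen Edge M M'

/-- The type of a multiline queue. -/
def type (M : MLQ lam n) : Fin n → ℕ := MultilineQueue.type (height lam) n M.1

/-- The type of the collapse `ρ(M)`, which is an arrangement on the same `λ₁ × n` array. -/
def collapseType (M : MLQ lam n) : Fin n → ℕ :=
  MultilineQueue.type (height lam) n (collapse (height lam) n M.1)

/-- The recording tableau of a multiline queue. -/
def recording (M : MLQ lam n) : ℕ → List ℕ := MultilineQueue.recording (height lam) n M.1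

end MLQ

end MultilineQueue

/-! Both brackets are governed by differences of counting functions: the dropping operator acts just
after the last maximum of `rowBal`, and the column operator acts just above the last maximum of
`colBal` (`eDown_eq`, `fRight_eq`). A horizontal step changes the row balance at one point only and
keeps its maximum, and the same holds with rows and columns exchanged, so the two kinds of operators
commute (`eDown_fRight_comm`). Compositions of dropping operators and of their inverses `fUp` are
therefore vertical maps (`IsVertical`): they commute with all column operators, and the row sizes of
their values are constant on crystal components. Every configuration is reached from a column
highest weight one (`exists_colHw`), so vertical maps can be compared there.

The recording tableau encodes the sizes of the rows `1, …, k + 1` after each stage `k`, hence is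
constant on components. Conversely, if `A` is of column highest weight, these rows are initial
intervals of columns, because nothing can be dropped among them. Their sizes tell how many balls
each column has in rows up to `k + 1`, and stage `k` has not changed these numbers. So the tableau
determines `A` (`eq_of_rowCard_stage`), and two queues with equal tableaux come from the same
highest weight element.

For the type, pairing is a queue: the set of columns with label at least `k` is passed down by
cyclic pairing, whatever the order within a label. Exchanging the sizes of two adjacent rows by
raising balls performs exactly this pairing, so the columns with type at least `k` form the bottom
row of a vertical image of `M` (`typeSet_eq_row`). Drops above row `1` do not change that bottom
row, and one upward sweep then leaves nothing to drop. By uniqueness the result is the collapse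
(`IsVertical.eq_collapse`). Finally the sweep is undone inside the bottom row: the level sets of the
type of the collapse, with row sizes that depend only on the component, successively determine the
original bottom row (`row_one_eq_of_typeSet_eq`). -/

namespace MultilineQueue

/-! ### Rows, columns and counting functions -/

/-- The columns of the balls in row `r`. -/
def row (M : Config) (r : ℕ) : Finset ℕ := (M.filter fun s => s.1 = r).image Prod.snd

/-- The rows of the balls in column `c`. -/
def col (M : Config) (c : ℕ) : Finset ℕ := (M.filter fun s => s.2 = c).image Prod.fst

@[simp] theorem mem_row {M : Config} {r c : ℕ} : c ∈ row M r ↔ (r, c) ∈ M := by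
  simp [row]

@[simp] theorem mem_col {M : Config} {r c : ℕ} : r ∈ col M c ↔ (r, c) ∈ M := by
  simp [col]

theorem card_row (M : Config) (r : ℕ) : (row M r).card = rowCard M r := by
  unfold row rowCard
  apply Finset.card_image_of_injOn
  rintro ⟨a, b⟩ h ⟨c, d⟩ h' e
  simp at h h' e
  simp [h.2, h'.2, e]

/-- The number of elements of `A` that are at most `x`. -/
def pre (A : Finset ℕ) (x : ℕ) : ℤ := ((A.filter (· ≤ x)).card : ℤ)

theorem pre_nonneg (A : Finset ℕ) (x : ℕ) : 0 ≤ pre A x := by unfold pre; positivity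

theorem pre_succ (A : Finset ℕ) (x : ℕ) :
    pre A (x + 1) = pre A x + if x + 1 ∈ A then 1 else 0 := by
  unfold pre
  have : A.filter (· ≤ x + 1) = if x + 1 ∈ A then insert (x + 1) (A.filter (· ≤ x))
      else A.filter (· ≤ x) := by
    ext y
    split_ifs with h
    · simp only [Finset.mem_filter, Finset.mem_insert]
      constructor
      · rintro ⟨h1, h2⟩
        rcases Nat.lt_or_ge x y with h3 | h3
        · left; omega
        · right; exact ⟨h1, h3⟩
      · rintro (rfl | ⟨h1, h2⟩)
        · exact ⟨h, le_rfl⟩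
        · exact ⟨h1, by omega⟩
    · simp only [Finset.mem_filter]
      constructor
      · rintro ⟨h1, h2⟩
        refine ⟨h1, ?_⟩
        rcases Nat.lt_or_ge x y with h3 | h3
        · exact absurd (by rwa [show x + 1 = y by omega]) h
        · exact h3
      · rintro ⟨h1, h2⟩
        exact ⟨h1, by omega⟩
  rw [this]
  split_ifs with h
  · rw [Finset.card_insert_of_notMem (by simp)]
    push_cast; ring
  · simp

theorem pre_zero {A : Finset ℕ} (h : 0 ∉ A) : pre A 0 = 0 := by
  unfold pre
  simp only [Nat.le_zero, Nat.cast_eq_zero, Finset.card_eq_zero]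
  ext y
  simp only [Finset.mem_filter, Finset.notMem_empty, iff_false, not_and]
  rintro hy rfl
  exact h hy

theorem pre_mono (A : Finset ℕ) {x y : ℕ} (h : x ≤ y) : pre A x ≤ pre A y := by
  unfold pre
  exact_mod_cast Finset.card_le_card fun z hz => by
    simp only [Finset.mem_filter] at hz ⊢
    exact ⟨hz.1, hz.2.trans h⟩

theorem pre_of_le {A : Finset ℕ} {n x : ℕ} (h : A ⊆ Finset.Icc 1 n) (hx : n ≤ x) :
    pre A x = A.card := by
  unfold pre
  rw [Finset.filter_true_of_mem]
  intro a ha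
  have := h ha
  simp only [Finset.mem_Icc] at this
  omega

/-- Moving a ball from the site `s` to the site `t`. -/
def mv (M : Config) (s t : ℕ × ℕ) : Config := insert t (M.erase s)

theorem mem_mv {M : Config} {s t u : ℕ × ℕ} : u ∈ mv M s t ↔ u = t ∨ (u ≠ s ∧ u ∈ M) := by
  simp [mv]

theorem card_filter_mv {M : Config} {s t : ℕ × ℕ} (hs : s ∈ M) (ht : t ∉ M) (p : ℕ × ℕ → Prop)
    [DecidablePred p] :
    (((mv M s t).filter p).card : ℤ) =
      (M.filter p).card - (if p s then 1 else 0) + if p t then 1 else 0 := by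
  unfold mv
  rw [Finset.natCast_card_filter, Finset.natCast_card_filter, Finset.sum_insert (by simp [ht]),
    Finset.sum_erase_eq_sub hs]
  ring

theorem card_mv {M : Config} {s t : ℕ × ℕ} (hs : s ∈ M) (ht : t ∉ M) : (mv M s t).card = M.card := by
  have := card_filter_mv hs ht (fun _ => True)
  simpa using this

theorem pre_row (M : Config) (r x : ℕ) :
    pre (row M r) x = ((M.filter fun s => s.1 = r ∧ s.2 ≤ x).card : ℤ) := by
  unfold pre
  congr 1
  symm
  apply Finset.card_bij (fun s _ => s.2)
  · rintro ⟨a, b⟩ h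
    simp only [Finset.mem_filter] at h
    obtain ⟨h1, rfl, h3⟩ := h
    simp [h1, h3]
  · rintro ⟨a, b⟩ h ⟨c, d⟩ h' e
    simp at h h' e
    simp [h.2, h'.2, e]
  · intro b hb
    simp only [Finset.mem_filter, mem_row] at hb
    exact ⟨(r, b), by simp [hb], rfl⟩

theorem pre_col (M : Config) (c x : ℕ) :
    pre (col M c) x = ((M.filter fun s => s.2 = c ∧ s.1 ≤ x).card : ℤ) := by
  unfold pre
  congr 1
  symm
  apply Finset.card_bij (fun s _ => s.1)
  · rintro ⟨a, b⟩ h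
    simp only [Finset.mem_filter] at h
    obtain ⟨h1, rfl, h3⟩ := h
    simp [h1, h3]
  · rintro ⟨a, b⟩ h ⟨c, d⟩ h' e
    simp at h h' e
    simp [h.2, h'.2, e]
  · intro b hb
    simp only [Finset.mem_filter, mem_col] at hb
    exact ⟨(b, c), by simp [hb], rfl⟩

theorem pre_row_mv {M : Config} {s t : ℕ × ℕ} (hs : s ∈ M) (ht : t ∉ M) (r x : ℕ) :
    pre (row (mv M s t) r) x = pre (row M r) x - (if s.1 = r ∧ s.2 ≤ x then 1 else 0) +
      if t.1 = r ∧ t.2 ≤ x then 1 else 0 := by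
  rw [pre_row, pre_row, card_filter_mv hs ht]

theorem pre_col_mv {M : Config} {s t : ℕ × ℕ} (hs : s ∈ M) (ht : t ∉ M) (c x : ℕ) :
    pre (col (mv M s t) c) x = pre (col M c) x - (if s.2 = c ∧ s.1 ≤ x then 1 else 0) +
      if t.2 = c ∧ t.1 ≤ x then 1 else 0 := by
  rw [pre_col, pre_col, card_filter_mv hs ht]

theorem rowCard_mv {M : Config} {s t : ℕ × ℕ} (hs : s ∈ M) (ht : t ∉ M) (r : ℕ) :
    (rowCard (mv M s t) r : ℤ) = rowCard M r - (if s.1 = r then 1 else 0) +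
      if t.1 = r then 1 else 0 := by
  unfold rowCard
  rw [card_filter_mv hs ht]

/-- The `L × n` array. -/
abbrev box (L n : ℕ) : Config := Finset.Icc 1 L ×ˢ Finset.Icc 1 n

theorem row_subset {M : Config} {L n : ℕ} (hM : M ⊆ box L n) (r : ℕ) :
    row M r ⊆ Finset.Icc 1 n := by
  intro c hc
  have := hM (mem_row.1 hc)
  simp only [Finset.mem_product] at this
  exact this.2

theorem col_subset {M : Config} {L n : ℕ} (hM : M ⊆ box L n) (c : ℕ) :
    col M c ⊆ Finset.Icc 1 L := by
  intro r hr
  have := hM (mem_col.1 hr)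
  simp only [Finset.mem_product] at this
  exact this.1

theorem mv_subset {M : Config} {L n : ℕ} (hM : M ⊆ box L n) {s t : ℕ × ℕ} (ht : t ∈ box L n) :
    mv M s t ⊆ box L n := by
  intro u hu
  rcases mem_mv.1 hu with rfl | h
  · exact ht
  · exact hM h.2

theorem zero_notMem_of_subset {A : Finset ℕ} {n : ℕ} (h : A ⊆ Finset.Icc 1 n) : 0 ∉ A := by
  intro h0
  have := h h0
  simp at this

/-- The excess of row `j` over row `j + 1` in the columns up to `x`. -/
def rowBal (M : Config) (j x : ℕ) : ℤ := pre (row M j) x - pre (row M (j + 1)) x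

/-- The excess of column `i + 1` over column `i` in the rows up to `s`. -/
def colBal (M : Config) (i s : ℕ) : ℤ := pre (col M (i + 1)) s - pre (col M i) s

theorem rowBal_zero {M : Config} {L n : ℕ} (hM : M ⊆ box L n) (j : ℕ) : rowBal M j 0 = 0 := by
  unfold rowBal
  rw [pre_zero (zero_notMem_of_subset (row_subset hM _)),
    pre_zero (zero_notMem_of_subset (row_subset hM _)), sub_self]

theorem colBal_zero {M : Config} {L n : ℕ} (hM : M ⊆ box L n) (i : ℕ) : colBal M i 0 = 0 := by
  unfold colBal
  rw [pre_zero (zero_notMem_of_subset (col_subset hM _)),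
    pre_zero (zero_notMem_of_subset (col_subset hM _)), sub_self]

theorem rowBal_succ (M : Config) (j x : ℕ) :
    rowBal M j (x + 1) = rowBal M j x + (if (j, x + 1) ∈ M then 1 else 0) -
      if (j + 1, x + 1) ∈ M then 1 else 0 := by
  unfold rowBal
  rw [pre_succ, pre_succ]
  simp only [mem_row]
  ring

theorem colBal_succ (M : Config) (i s : ℕ) :
    colBal M i (s + 1) = colBal M i s + (if (s + 1, i + 1) ∈ M then 1 else 0) -
      if (s + 1, i) ∈ M then 1 else 0 := by
  unfold colBal
  rw [pre_succ, pre_succ]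
  simp only [mem_col]
  ring

theorem rowBal_of_le {M : Config} {L n x : ℕ} (hM : M ⊆ box L n) (hx : n ≤ x) (j : ℕ) :
    rowBal M j x = rowCard M j - rowCard M (j + 1) := by
  unfold rowBal
  rw [pre_of_le (row_subset hM _) hx, pre_of_le (row_subset hM _) hx, card_row, card_row]

/-- `x` is the last point of `[0, N]` where `f` attains its maximum. -/
def LastMax (f : ℕ → ℤ) (N x : ℕ) : Prop :=
  x ≤ N ∧ ∀ y ≤ N, f y ≤ f x ∧ (x < y → f y < f x)

/-- `x` is the first point of `[0, N]` where `f` attains its maximum. -/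
def FirstMax (f : ℕ → ℤ) (N x : ℕ) : Prop :=
  x ≤ N ∧ ∀ y ≤ N, f y ≤ f x ∧ (y < x → f y < f x)

theorem exists_lastMax (f : ℕ → ℤ) (N : ℕ) : ∃ x, LastMax f N x := by
  induction N with
  | zero => exact ⟨0, le_rfl, fun y hy => ⟨by simp_all, by omega⟩⟩
  | succ N ih =>
    obtain ⟨x, hx, h⟩ := ih
    by_cases hc : f x ≤ f (N + 1)
    · refine ⟨N + 1, le_rfl, fun y hy => ⟨?_, by omega⟩⟩
      rcases Nat.lt_or_ge N y with h1 | h1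
      · rw [show y = N + 1 by omega]
      · exact (h y h1).1.trans hc
    · refine ⟨x, by omega, fun y hy => ?_⟩
      rcases Nat.lt_or_ge N y with h1 | h1
      · rw [show y = N + 1 by omega]
        constructor
        · omega
        · intro; omega
      · exact h y h1

theorem exists_firstMax (f : ℕ → ℤ) (N : ℕ) : ∃ x, FirstMax f N x := by
  induction N with
  | zero => exact ⟨0, le_rfl, fun y hy => ⟨by simp_all, by omega⟩⟩
  | succ N ih =>
    obtain ⟨x, hx, h⟩ := ih
    by_cases hc : f x < f (N + 1)
    · refine ⟨N + 1, le_rfl, fun y hy => ?_⟩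
      rcases Nat.lt_or_ge N y with h1 | h1
      · rw [show y = N + 1 by omega]
        exact ⟨le_rfl, by omega⟩
      · have := (h y h1).1
        exact ⟨by omega, by intro; omega⟩
    · refine ⟨x, by omega, fun y hy => ?_⟩
      rcases Nat.lt_or_ge N y with h1 | h1
      · rw [show y = N + 1 by omega]
        constructor
        · omega
        · intro; omega
      · exact h y h1

theorem FirstMax.unique {f : ℕ → ℤ} {N x y : ℕ} (hx : FirstMax f N x) (hy : FirstMax f N y) :
    x = y := by
  rcases Nat.lt_trichotomy x y with h | h | h
  · have := (hy.2 x hx.1).2 h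
    have := (hx.2 y hy.1).1
    omega
  · exact h
  · have := (hx.2 y hy.1).2 h
    have := (hy.2 x hx.1).1
    omega

/-! ### Bracketing -/

/-- Reading an opening parenthesis at `x` if `b` holds. -/
def openIf {α : Type} (b : Prop) [Decidable b] (x : α) (st : List α × List α) : List α × List α :=
  if b then (st.1, x :: st.2) else st

/-- Reading a closing parenthesis at `x` if `b` holds. -/
def closeIf {α : Type} (b : Prop) [Decidable b] (x : α) (st : List α × List α) :
    List α × List α :=
  if b then (match st.2 with
    | [] => (x :: st.1, [])
    | _ :: op => (st.1, op)) else st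

/-- Only two letters of a block matter, and since the block is read downwards the opening one comes
first. Two balls side by side in the same block thus cancel each other, in agreement with the
balance functions. -/
theorem foldl_block {α : Type} [DecidableEq α] (M : Finset α) (key : α → ℕ) (φ : ℕ → α)
    (hφ : ∀ p, key (φ p) = p) (i N : ℕ) (st : List α × List α) :
    ((List.range' 1 N).reverse.map φ).foldl
        (fun st s => if s ∈ M then bracketStep key (i + 1) st s else st) st =
      if N < i + 1 then st
      else if N = i + 1 then closeIf (φ (i + 1) ∈ M) (φ (i + 1)) st
      else closeIf (φ (i + 1) ∈ M) (φ (i + 1)) (openIf (φ (i + 2) ∈ M) (φ (i + 2)) st) := by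
  induction N generalizing st with
  | zero => simp
  | succ N ih =>
    rw [List.range'_1_concat, List.reverse_append, List.map_append, List.foldl_append, ih]
    simp only [List.reverse_cons, List.reverse_nil, List.nil_append, List.map_cons, List.map_nil,
      List.foldl_cons, List.foldl_nil]
    have e : 1 + N = N + 1 := by omega
    rw [e]
    generalize hst : (if φ (N + 1) ∈ M then bracketStep key (i + 1) st (φ (N + 1)) else st) = st'
    simp only [bracketStep, hφ] at hst
    rcases Nat.lt_trichotomy N i with h | h | h
    · rw [if_neg (show ¬(N + 1 = i + 1) by omega), if_neg (show ¬(N + 1 = i + 1 + 1) by omega),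
        ite_self] at hst
      rw [if_pos (by omega), if_pos (by omega), hst]
    · subst h
      rw [if_pos (by omega), if_neg (by omega), if_pos rfl, ← hst]
      rcases st with ⟨cl, _ | ⟨o, op⟩⟩ <;> simp [closeIf]
    · rcases Nat.lt_or_ge (i + 1) N with h' | h'
      · rw [if_neg (show ¬(N + 1 = i + 1) by omega), if_neg (show ¬(N + 1 = i + 1 + 1) by omega),
          ite_self] at hst
        rw [if_neg (by omega), if_neg (by omega), if_neg (by omega), if_neg (by omega), hst]
      · obtain rfl : N = i + 1 := by omega
        rw [if_neg (by omega), if_pos rfl, if_neg (by omega), if_neg (by omega), ← hst]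
        simp [openIf]

theorem unmatched_colReading {L n i : ℕ} (M : Config) (hi : i + 1 < L) :
    unmatched Prod.fst (i + 1) (colReading L n M) =
      (List.range' 1 n).foldl (fun st c => closeIf ((i + 1, c) ∈ M) (i + 1, c)
        (openIf ((i + 2, c) ∈ M) (i + 2, c) st)) ([], []) := by
  unfold unmatched colReading
  rw [List.foldl_filter, List.foldl_flatMap]
  congr 1
  funext st c
  have := foldl_block M Prod.fst (fun r => (r, c)) (fun _ => rfl) i L st
  rw [if_neg (by omega), if_neg (by omega)] at this
  simpa using this

theorem unmatched_rowReading {L n i : ℕ} (M : Config) (hi : i + 1 < n) :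
    unmatched Prod.snd (i + 1) (rowReading L n M) =
      (List.range' 1 L).reverse.foldl (fun st r => closeIf ((r, i + 1) ∈ M) (r, i + 1)
        (openIf ((r, i + 2) ∈ M) (r, i + 2) st)) ([], []) := by
  unfold unmatched rowReading
  rw [List.foldl_filter, List.foldl_flatMap]
  congr 1
  funext st r
  have := foldl_block M Prod.snd (fun c => (r, c)) (fun _ => rfl) i n st
  rw [if_neg (by omega), if_neg (by omega)] at this
  simpa using this

/-- The bracketing state after the first `x` columns. -/
def colScan (M : Config) (j x : ℕ) : List (ℕ × ℕ) × List (ℕ × ℕ) :=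
  (List.range' 1 x).foldl (fun st c => closeIf ((j, c) ∈ M) (j, c)
    (openIf ((j + 1, c) ∈ M) (j + 1, c) st)) ([], [])

theorem colScan_succ (M : Config) (j x : ℕ) :
    colScan M j (x + 1) = closeIf ((j, x + 1) ∈ M) (j, x + 1)
      (openIf ((j + 1, x + 1) ∈ M) (j + 1, x + 1) (colScan M j x)) := by
  unfold colScan
  rw [List.range'_1_concat, List.foldl_append]
  simp [Nat.add_comm]

/-- The number of open parentheses is the running maximum of the balance minus its present value; a
closing parenthesis that stays unmatched is a new record. -/
theorem colScan_open_length (M : Config) (j x : ℕ) :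
    (∀ y ≤ x, rowBal M j y ≤ rowBal M j x + (colScan M j x).2.length) ∧
      ∃ y ≤ x, rowBal M j y = rowBal M j x + (colScan M j x).2.length := by
  induction x with
  | zero => exact ⟨fun y hy => by simp_all [colScan], 0, le_rfl, by simp [colScan]⟩
  | succ x ih =>
    obtain ⟨h1, z, hz, h2⟩ := ih
    have key : (rowBal M j (x + 1) + (colScan M j (x + 1)).2.length =
        rowBal M j x + (colScan M j x).2.length ∧
        rowBal M j (x + 1) ≤ rowBal M j x + (colScan M j x).2.length) ∨
        ((colScan M j (x + 1)).2.length = 0 ∧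
          rowBal M j (x + 1) = rowBal M j x + (colScan M j x).2.length + 1) := by
      rw [rowBal_succ, colScan_succ]
      rcases colScan M j x with ⟨cl, op⟩
      by_cases ha : (j, x + 1) ∈ M <;> by_cases hb : (j + 1, x + 1) ∈ M <;>
        rcases op with _ | ⟨o, op⟩ <;> simp [ha, hb, openIf, closeIf] <;> omega
    rcases key with ⟨k1, k2⟩ | ⟨k1, k2⟩
    · rw [k1]
      refine ⟨fun y hy => ?_, z, by omega, h2⟩
      rcases Nat.lt_or_ge x y with h | h
      · rw [show y = x + 1 by omega]; exact k2
      · exact h1 y h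
    · refine ⟨fun y hy => ?_, x + 1, le_rfl, by simp [k1]⟩
      rcases Nat.lt_or_ge x y with h | h
      · rw [show y = x + 1 by omega]; omega
      · have := h1 y h
        omega

/-- At the last maximum nothing is open. Afterwards the balance stays strictly below its maximum, so
the parenthesis opened at `x + 1` is never closed and remains at the bottom of the stack. -/
theorem colScan_after {M : Config} {n j x : ℕ} (hx : LastMax (rowBal M j) n x) (hxn : x < n) :
    ∀ y, x < y → y ≤ n → ∃ op, (colScan M j y).2 = op ++ [(j + 1, x + 1)] ∧
      (op.length : ℤ) = rowBal M j x - 1 - rowBal M j y := by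
  intro y hxy
  induction y, hxy using Nat.le_induction with
  | base =>
    intro _
    have h0 : (colScan M j x).2 = [] := by
      obtain ⟨y, hy, h⟩ := (colScan_open_length M j x).2
      have := (hx.2 y (by omega)).1
      exact List.length_eq_zero_iff.1 (by omega)
    have h1 := (hx.2 (x + 1) hxn).2 (by omega)
    have h2 := rowBal_succ M j x
    rw [colScan_succ]
    refine ⟨[], ?_, ?_⟩
    · by_cases ha : (j, x + 1) ∈ M <;> by_cases hb : (j + 1, x + 1) ∈ M <;>
        simp [ha, hb] at h2 <;> first | omega | simp [openIf, closeIf, ha, hb, h0]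
    · rw [h2] at h1 ⊢
      split_ifs at h1 ⊢ <;> simp at h1 ⊢
  | succ y hy ih =>
    intro hyn
    obtain ⟨op, h1, h2⟩ := ih (by omega)
    have h3 := (hx.2 (y + 1) hyn).2 (by omega)
    have h4 := rowBal_succ M j y
    rw [colScan_succ]
    rcases hc : colScan M j y with ⟨cl, op'⟩
    rw [hc] at h1
    simp only at h1
    subst h1
    by_cases ha : (j, y + 1) ∈ M <;> by_cases hb : (j + 1, y + 1) ∈ M <;>
      simp only [ha, hb, if_true, if_false] at h4
    · exact ⟨op, by simp [openIf, closeIf, ha, hb], by omega⟩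
    · rcases op with _ | ⟨o, op⟩
      · simp at h2; omega
      · refine ⟨op, by simp [openIf, closeIf, ha, hb], ?_⟩
        simp at h2; omega
    · exact ⟨(j + 1, y + 1) :: op, by simp [openIf, closeIf, ha, hb], by simp; omega⟩
    · exact ⟨op, by simp [openIf, closeIf, ha, hb], by omega⟩

/-- The bracketing state after `k` of the `L` rows, read from the top. -/
def rowScan (M : Config) (L i k : ℕ) : List (ℕ × ℕ) × List (ℕ × ℕ) :=
  (List.range' (L - k + 1) k).reverse.foldl (fun st r => closeIf ((r, i) ∈ M) (r, i)
    (openIf ((r, i + 1) ∈ M) (r, i + 1) st)) ([], [])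

theorem rowScan_succ (M : Config) {L k : ℕ} (i : ℕ) (hk : k < L) :
    rowScan M L i (k + 1) = closeIf ((L - k, i) ∈ M) (L - k, i)
      (openIf ((L - k, i + 1) ∈ M) (L - k, i + 1) (rowScan M L i k)) := by
  unfold rowScan
  rw [show L - (k + 1) + 1 = L - k by omega, List.range'_succ]
  simp [List.foldl_append]

theorem rowScan_open_length (M : Config) (L i k : ℕ) (hk : k ≤ L) :
    (∀ y, L - k ≤ y → y ≤ L → colBal M i y ≤ colBal M i (L - k) + (rowScan M L i k).2.length) ∧
      ∃ y, L - k ≤ y ∧ y ≤ L ∧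
        colBal M i y = colBal M i (L - k) + (rowScan M L i k).2.length := by
  induction k with
  | zero =>
    refine ⟨fun y hy hy' => ?_, L, by omega, le_rfl, by simp [rowScan]⟩
    rw [show y = L by omega]; simp [rowScan]
  | succ k ih =>
    obtain ⟨h1, z, hz, hz', h2⟩ := ih (by omega)
    obtain ⟨s, hs⟩ : ∃ s, L - k = s + 1 := ⟨L - k - 1, by omega⟩
    have hs' : L - (k + 1) = s := by omega
    rw [hs] at h1 h2
    rw [hs']
    have key : (colBal M i s + (rowScan M L i (k + 1)).2.length =
        colBal M i (s + 1) + (rowScan M L i k).2.length ∧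
        colBal M i s ≤ colBal M i (s + 1) + (rowScan M L i k).2.length) ∨
        ((rowScan M L i (k + 1)).2.length = 0 ∧
          colBal M i s = colBal M i (s + 1) + (rowScan M L i k).2.length + 1) := by
      rw [colBal_succ, rowScan_succ M i (by omega), hs]
      rcases rowScan M L i k with ⟨cl, op⟩
      by_cases ha : (s + 1, i) ∈ M <;> by_cases hb : (s + 1, i + 1) ∈ M <;>
        rcases op with _ | ⟨o, op⟩ <;> simp [ha, hb, openIf, closeIf] <;> omega
    rcases key with ⟨k1, k2⟩ | ⟨k1, k2⟩
    · rw [k1]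
      refine ⟨fun y hy hy' => ?_, z, by omega, hz', h2⟩
      rcases Nat.lt_or_ge s y with h | h
      · exact h1 y (by omega) hy'
      · rw [show y = s by omega]; exact k2
    · refine ⟨fun y hy hy' => ?_, s, le_rfl, by omega, by simp [k1]⟩
      rcases Nat.lt_or_ge s y with h | h
      · have := h1 y (by omega) hy'
        omega
      · rw [show y = s by omega]; omega

/-- Rows are read downwards, so the rows below the last maximum come after it. The balance never
exceeds its maximum there, so no further closing parenthesis stays unmatched. -/
theorem rowScan_after {M : Config} {L i s : ℕ} (hx : LastMax (colBal M i) L s)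
    (cl : List (ℕ × ℕ)) (h0 : rowScan M L i (L - s) = (cl, [])) :
    ∀ k, L - s ≤ k → k ≤ L → (rowScan M L i k).1 = cl ∧
      ((rowScan M L i k).2.length : ℤ) = colBal M i s - colBal M i (L - k) := by
  intro k hk
  have hsL := hx.1
  induction k, hk using Nat.le_induction with
  | base =>
    intro _
    rw [h0, show L - (L - s) = s by omega]
    simp
  | succ k hk ih =>
    intro hkL
    obtain ⟨h1, h2⟩ := ih (by omega)
    obtain ⟨t, ht⟩ : ∃ t, L - k = t + 1 := ⟨L - k - 1, by omega⟩
    have ht' : L - (k + 1) = t := by omega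
    have h3 := (hx.2 t (by omega)).1
    have h4 := colBal_succ M i t
    rw [rowScan_succ M i (by omega), ht']
    rw [ht] at h2 ⊢
    rcases hc : rowScan M L i k with ⟨cl', op⟩
    rw [hc] at h1 h2
    simp only at h1 h2
    subst h1
    by_cases ha : (t + 1, i) ∈ M <;> by_cases hb : (t + 1, i + 1) ∈ M <;>
      simp only [ha, hb, if_true, if_false] at h4
    · exact ⟨by simp [openIf, closeIf, ha, hb], by simp [openIf, closeIf, ha, hb]; omega⟩
    · rcases op with _ | ⟨o, op⟩
      · simp at h2; omega
      · refine ⟨by simp [openIf, closeIf, ha, hb], ?_⟩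
        simp at h2
        simp [openIf, closeIf, ha, hb]; omega
    · exact ⟨by simp [openIf, closeIf, ha, hb], by simp [openIf, closeIf, ha, hb]; omega⟩
    · exact ⟨by simp [openIf, closeIf, ha, hb], by simp [openIf, closeIf, ha, hb]; omega⟩

/-- The dropping operator acts just after the last maximum of the balance. -/
theorem eDown_eq {L n j x : ℕ} {M : Config} (h1 : 1 ≤ j) (hj : j < L)
    (hx : LastMax (rowBal M j) n x) :
    eDown L n j M = if x < n then mv M (j + 1, x + 1) (j, x + 1) else M := by
  obtain ⟨i, rfl⟩ : ∃ i, j = i + 1 := ⟨j - 1, by omega⟩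
  have e : unmatched Prod.fst (i + 1) (colReading L n M) = colScan M (i + 1) n :=
    unmatched_colReading M hj
  unfold eDown
  rw [e]
  split_ifs with hxn
  · obtain ⟨op, h, -⟩ := colScan_after hx hxn n hxn le_rfl
    rw [h, List.getLast?_concat]
    rfl
  · obtain rfl : x = n := by have := hx.1; omega
    have h0 : (colScan M (i + 1) x).2 = [] := by
      obtain ⟨y, hy, h⟩ := (colScan_open_length M (i + 1) x).2
      have := (hx.2 y (by omega)).1
      exact List.length_eq_zero_iff.1 (by omega)
    rw [h0]
    rfl

/-- The column operator acts just above the last maximum of the balance. -/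
theorem fRight_eq {L n i s : ℕ} {M : Config} (h1 : 1 ≤ i) (hi : i < n)
    (hs : LastMax (colBal M i) L s) :
    fRight L n i M = if s < L then mv M (s + 1, i) (s + 1, i + 1) else M := by
  obtain ⟨i, rfl⟩ : ∃ k, i = k + 1 := ⟨i - 1, by omega⟩
  have e : unmatched Prod.snd (i + 1) (rowReading L n M) = rowScan M L (i + 1) L := by
    rw [unmatched_rowReading M hi]
    unfold rowScan
    simp
  unfold fRight
  rw [e]
  split_ifs with hsL
  -- Above `s` the balance is at most its maximum minus one, and this value is taken at `s + 1`. So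
  -- nothing is open when row `s + 1` is read, and its ball becomes an unmatched closing
  -- parenthesis.
  · have h0 : (rowScan M L (i + 1) (L - (s + 1))).2 = [] := by
      obtain ⟨y, hy, hy', h⟩ := (rowScan_open_length M L (i + 1) (L - (s + 1)) (by omega)).2
      rw [show L - (L - (s + 1)) = s + 1 by omega] at h
      have a := (hs.2 y hy').2 (by omega)
      have b := (hs.2 (s + 1) hsL).2 (by omega)
      have c := colBal_succ M (i + 1) s
      have d : (if (s + 1, i + 1) ∈ M then (1 : ℤ) else 0) ≤ 1 := by split_ifs <;> simp
      have d' : (0 : ℤ) ≤ (if (s + 1, i + 1 + 1) ∈ M then (1 : ℤ) else 0) := by split_ifs <;> simp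
      exact List.length_eq_zero_iff.1 (by omega)
    have hstep : rowScan M L (i + 1) (L - s) =
        ((s + 1, i + 1) :: (rowScan M L (i + 1) (L - (s + 1))).1, []) := by
      rw [show L - s = (L - (s + 1)) + 1 by omega, rowScan_succ M _ (by omega),
        show L - (L - (s + 1)) = s + 1 by omega]
      have b := (hs.2 (s + 1) hsL).2 (by omega)
      have c := colBal_succ M (i + 1) s
      by_cases ha : (s + 1, i + 1) ∈ M <;> by_cases hb : (s + 1, i + 1 + 1) ∈ M <;>
        simp only [ha, hb, if_true, if_false] at c <;>
        first
        | omega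
        | simp [openIf, closeIf, ha, hb, h0]
    have := (rowScan_after hs _ hstep L (by omega) le_rfl).1
    rw [this]
    rfl
  · obtain rfl : s = L := by have := hs.1; omega
    have := (rowScan_after hs [] (by simp [rowScan]) s (by omega) le_rfl).1
    rw [this]
    rfl

/-! ### The operators commute -/

theorem LastMax.mem_row {M : Config} {n j x : ℕ} (h : LastMax (rowBal M j) n x) (hx : x < n) :
    (j + 1, x + 1) ∈ M ∧ (j, x + 1) ∉ M := by
  have h1 := (h.2 (x + 1) hx).2 (by omega)
  rw [rowBal_succ] at h1
  split_ifs at h1 with ha hb <;> first | omega | exact ⟨by assumption, by assumption⟩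

theorem LastMax.mem_col {M : Config} {L i s : ℕ} (h : LastMax (colBal M i) L s) (hs : s < L) :
    (s + 1, i) ∈ M ∧ (s + 1, i + 1) ∉ M := by
  have h1 := (h.2 (s + 1) hs).2 (by omega)
  rw [colBal_succ] at h1
  split_ifs at h1 with ha hb <;> first | omega | exact ⟨by assumption, by assumption⟩

theorem FirstMax.mem_row {M : Config} {n j x : ℕ} (h : FirstMax (rowBal M j) n (x + 1)) :
    (j, x + 1) ∈ M ∧ (j + 1, x + 1) ∉ M := by
  have h1 := (h.2 x (by have := h.1; omega)).2 (by omega)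
  rw [rowBal_succ] at h1
  split_ifs at h1 with ha hb <;> first | omega | exact ⟨by assumption, by assumption⟩

theorem rowBal_mv_right {M : Config} {s i : ℕ} (h1 : (s + 1, i) ∈ M) (h2 : (s + 1, i + 1) ∉ M)
    (j y : ℕ) :
    rowBal (mv M (s + 1, i) (s + 1, i + 1)) j y = rowBal M j y +
      if y = i then (if s = j then 1 else 0) - (if s + 1 = j then 1 else 0) else 0 := by
  unfold rowBal
  rw [pre_row_mv h1 h2, pre_row_mv h1 h2]
  simp only
  split_ifs <;> omega

theorem colBal_mv_down {M : Config} {j x : ℕ} (h1 : (j + 1, x + 1) ∈ M) (h2 : (j, x + 1) ∉ M)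
    (i t : ℕ) :
    colBal (mv M (j + 1, x + 1) (j, x + 1)) i t = colBal M i t +
      if t = j then (if x = i then 1 else 0) - (if x + 1 = i then 1 else 0) else 0 := by
  unfold colBal
  rw [pre_col_mv h1 h2, pre_col_mv h1 h2]
  simp only
  split_ifs <;> omega

section

variable {M : Config} {L n i j x s : ℕ}

/-- The move changes the row balance only at `i + 1`, by at most one. The last maximum can shift
only when both operators act in the same `2 × 2` square; its value never changes. -/
theorem lastMax_row_mv (hx : LastMax (rowBal M (j + 1)) n x) (hs : LastMax (colBal M (i + 1)) L s)
    (hj : j + 1 < L) (hi : i + 1 < n) (hsL : s < L) :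
    ∃ x', LastMax (rowBal (mv M (s + 1, i + 1) (s + 1, i + 2)) (j + 1)) n x' ∧
      rowBal (mv M (s + 1, i + 1) (s + 1, i + 2)) (j + 1) x' = rowBal M (j + 1) x ∧
      ((s = j + 1 ∧ x = i ∧ x' = i + 1) ∨ (s = j ∧ x = i + 1 ∧ x' = i) ∨
        (¬(s = j + 1 ∧ x = i) ∧ ¬(s = j ∧ x = i + 1) ∧ x' = x)) := by
  obtain ⟨m1, m2⟩ := hs.mem_col hsL
  have e := rowBal_mv_right m1 m2 (j + 1)
  have r1 := rowBal_succ M (j + 1) i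
  have r2 := rowBal_succ M (j + 1) (i + 1)
  have c1 := colBal_succ M (i + 1) j
  have c2 := colBal_succ M (i + 1) (j + 1)
  -- The occupation numbers of the four sites of the square occur in the increments of both
  -- balances. This link, with the two maximality conditions, reduces everything to linear
  -- arithmetic.
  obtain ⟨a, ha, ha'⟩ : ∃ a : ℤ, (if (j + 2, i + 1) ∈ M then (1 : ℤ) else 0) = a ∧ 0 ≤ a ∧ a ≤ 1 :=
    ⟨_, rfl, by split_ifs <;> simp⟩
  obtain ⟨b, hb, hb'⟩ : ∃ a : ℤ, (if (j + 2, i + 2) ∈ M then (1 : ℤ) else 0) = a ∧ 0 ≤ a ∧ a ≤ 1 :=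
    ⟨_, rfl, by split_ifs <;> simp⟩
  obtain ⟨p, hp, hp'⟩ : ∃ a : ℤ, (if (j + 1, i + 1) ∈ M then (1 : ℤ) else 0) = a ∧ 0 ≤ a ∧ a ≤ 1 :=
    ⟨_, rfl, by split_ifs <;> simp⟩
  obtain ⟨q, hq, hq'⟩ : ∃ a : ℤ, (if (j + 1, i + 2) ∈ M then (1 : ℤ) else 0) = a ∧ 0 ≤ a ∧ a ≤ 1 :=
    ⟨_, rfl, by split_ifs <;> simp⟩
  have r1' : rowBal M (j + 1) (i + 1) = rowBal M (j + 1) i + p - a := by rw [r1, hp, ha]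
  have r2' : rowBal M (j + 1) (i + 2) = rowBal M (j + 1) (i + 1) + q - b := by rw [r2, hq, hb]
  have c1' : colBal M (i + 1) (j + 1) = colBal M (i + 1) j + q - p := by rw [c1, hp, hq]
  have c2' : colBal M (i + 1) (j + 2) = colBal M (i + 1) (j + 1) + b - a := by rw [c2, ha, hb]
  clear r1 r2 c1 c2 ha hb hp hq
  have x0 := hx.2 i (by omega)
  have x1 := hx.2 (i + 1) (by omega)
  have x2 := hx.2 (i + 2) (by omega)
  have s0 := hs.2 j (by omega)
  have s1 := hs.2 (j + 1) (by omega)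
  have s2 := hs.2 (j + 2) (by omega)
  have ex0 : x = i → rowBal M (j + 1) x = rowBal M (j + 1) i := fun h => by rw [h]
  have ex1 : x = i + 1 → rowBal M (j + 1) x = rowBal M (j + 1) (i + 1) := fun h => by rw [h]
  have es0 : s = j → colBal M (i + 1) s = colBal M (i + 1) j := fun h => by rw [h]
  have es1 : s = j + 1 → colBal M (i + 1) s = colBal M (i + 1) (j + 1) := fun h => by rw [h]
  have hxn := hx.1
  by_cases k1 : s = j + 1 ∧ x = i
  · obtain ⟨rfl, rfl⟩ := k1
    refine ⟨x + 1, ⟨by omega, fun y hy => ?_⟩, ?_, by omega⟩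
    · have hy0 := hx.2 y hy
      have ey : y = x → rowBal M (j + 1) y = rowBal M (j + 1) x := fun h => by rw [h]
      rw [e, e]
      split_ifs <;> omega
    · rw [e]
      split_ifs <;> omega
  by_cases k2 : s = j ∧ x = i + 1
  · obtain ⟨rfl, rfl⟩ := k2
    refine ⟨i, ⟨by omega, fun y hy => ?_⟩, ?_, by omega⟩
    · have hy0 := hx.2 y hy
      rw [e, e]
      split_ifs <;> omega
    · rw [e]
      split_ifs <;> omega
  refine ⟨x, ⟨by omega, fun y hy => ?_⟩, ?_, by omega⟩
  · have hy0 := hx.2 y hy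
    have ey : y = i + 1 → rowBal M (j + 1) y = rowBal M (j + 1) (i + 1) := fun h => by rw [h]
    rw [e, e]
    split_ifs <;> omega
  · rw [e]
    split_ifs <;> omega

/-- The transpose of `lastMax_row_mv`, with the same two exceptional positions. -/
theorem lastMax_col_mv (hx : LastMax (rowBal M (j + 1)) n x) (hs : LastMax (colBal M (i + 1)) L s)
    (hj : j + 1 < L) (hi : i + 1 < n) (hxn : x < n) :
    ∃ s', LastMax (colBal (mv M (j + 2, x + 1) (j + 1, x + 1)) (i + 1)) L s' ∧
      colBal (mv M (j + 2, x + 1) (j + 1, x + 1)) (i + 1) s' = colBal M (i + 1) s ∧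
      ((s = j + 1 ∧ x = i ∧ s' = j) ∨ (s = j ∧ x = i + 1 ∧ s' = j + 1) ∨
        (¬(s = j + 1 ∧ x = i) ∧ ¬(s = j ∧ x = i + 1) ∧ s' = s)) := by
  obtain ⟨m1, m2⟩ := hx.mem_row hxn
  have e := colBal_mv_down m1 m2 (i + 1)
  have r1 := rowBal_succ M (j + 1) i
  have r2 := rowBal_succ M (j + 1) (i + 1)
  have c1 := colBal_succ M (i + 1) j
  have c2 := colBal_succ M (i + 1) (j + 1)
  obtain ⟨a, ha, ha'⟩ : ∃ a : ℤ, (if (j + 2, i + 1) ∈ M then (1 : ℤ) else 0) = a ∧ 0 ≤ a ∧ a ≤ 1 :=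
    ⟨_, rfl, by split_ifs <;> simp⟩
  obtain ⟨b, hb, hb'⟩ : ∃ a : ℤ, (if (j + 2, i + 2) ∈ M then (1 : ℤ) else 0) = a ∧ 0 ≤ a ∧ a ≤ 1 :=
    ⟨_, rfl, by split_ifs <;> simp⟩
  obtain ⟨p, hp, hp'⟩ : ∃ a : ℤ, (if (j + 1, i + 1) ∈ M then (1 : ℤ) else 0) = a ∧ 0 ≤ a ∧ a ≤ 1 :=
    ⟨_, rfl, by split_ifs <;> simp⟩
  obtain ⟨q, hq, hq'⟩ : ∃ a : ℤ, (if (j + 1, i + 2) ∈ M then (1 : ℤ) else 0) = a ∧ 0 ≤ a ∧ a ≤ 1 :=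
    ⟨_, rfl, by split_ifs <;> simp⟩
  have r1' : rowBal M (j + 1) (i + 1) = rowBal M (j + 1) i + p - a := by rw [r1, hp, ha]
  have r2' : rowBal M (j + 1) (i + 2) = rowBal M (j + 1) (i + 1) + q - b := by rw [r2, hq, hb]
  have c1' : colBal M (i + 1) (j + 1) = colBal M (i + 1) j + q - p := by rw [c1, hp, hq]
  have c2' : colBal M (i + 1) (j + 2) = colBal M (i + 1) (j + 1) + b - a := by rw [c2, ha, hb]
  clear r1 r2 c1 c2 ha hb hp hq
  have x0 := hx.2 i (by omega)
  have x1 := hx.2 (i + 1) (by omega)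
  have x2 := hx.2 (i + 2) (by omega)
  have s0 := hs.2 j (by omega)
  have s1 := hs.2 (j + 1) (by omega)
  have s2 := hs.2 (j + 2) (by omega)
  have ex0 : x = i → rowBal M (j + 1) x = rowBal M (j + 1) i := fun h => by rw [h]
  have ex1 : x = i + 1 → rowBal M (j + 1) x = rowBal M (j + 1) (i + 1) := fun h => by rw [h]
  have es0 : s = j → colBal M (i + 1) s = colBal M (i + 1) j := fun h => by rw [h]
  have es1 : s = j + 1 → colBal M (i + 1) s = colBal M (i + 1) (j + 1) := fun h => by rw [h]
  have hsL := hs.1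
  by_cases k1 : s = j + 1 ∧ x = i
  · obtain ⟨rfl, rfl⟩ := k1
    refine ⟨j, ⟨by omega, fun y hy => ?_⟩, ?_, by omega⟩
    · have hy0 := hs.2 y hy
      rw [e, e]
      split_ifs <;> omega
    · rw [e]
      split_ifs <;> omega
  by_cases k2 : s = j ∧ x = i + 1
  · obtain ⟨rfl, rfl⟩ := k2
    refine ⟨s + 1, ⟨by omega, fun y hy => ?_⟩, ?_, by omega⟩
    · have hy0 := hs.2 y hy
      have ey : y = s → colBal M (i + 1) y = colBal M (i + 1) s := fun h => by rw [h]
      rw [e, e]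
      split_ifs <;> omega
    · rw [e]
      split_ifs <;> omega
  refine ⟨s, ⟨by omega, fun y hy => ?_⟩, ?_, by omega⟩
  · have hy0 := hs.2 y hy
    have ey : y = j + 1 → colBal M (i + 1) y = colBal M (i + 1) (j + 1) := fun h => by rw [h]
    rw [e, e]
    split_ifs <;> omega
  · rw [e]
    split_ifs <;> omega

/-- The dropping operators commute with the column operators. -/
theorem eDown_fRight_comm (M : Config) {L n i j : ℕ} (hj1 : 1 ≤ j) (hj : j < L) (hi1 : 1 ≤ i)
    (hi : i < n) : eDown L n j (fRight L n i M) = fRight L n i (eDown L n j M) := by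
  obtain ⟨j, rfl⟩ : ∃ k, j = k + 1 := ⟨j - 1, by omega⟩
  obtain ⟨i, rfl⟩ : ∃ k, i = k + 1 := ⟨i - 1, by omega⟩
  obtain ⟨x, hx⟩ := exists_lastMax (rowBal M (j + 1)) n
  obtain ⟨s, hs⟩ := exists_lastMax (colBal M (i + 1)) L
  rw [fRight_eq hi1 hi hs, eDown_eq hj1 hj hx]
  by_cases hsL : s < L
  · rw [if_pos hsL]
    obtain ⟨x', hx', -, h1⟩ := lastMax_row_mv hx hs hj hi hsL
    rw [eDown_eq hj1 hj hx']
    by_cases hxn : x < n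
    · rw [if_pos hxn]
      obtain ⟨s', hs', -, h2⟩ := lastMax_col_mv hx hs hj hi hxn
      rw [fRight_eq hi1 hi hs']
      obtain ⟨p1, p2⟩ := hx.mem_row hxn
      obtain ⟨p3, p4⟩ := hs.mem_col hsL
      rcases h1 with ⟨rfl, rfl, rfl⟩ | ⟨rfl, rfl, rfl⟩ | ⟨n1, n2, rfl⟩
      -- A single ball in the square: both operators select it, and in either order it travels to
      -- the diagonally opposite corner.
      · obtain rfl : s' = j := by omega
        have p5 := (hs'.mem_col (by omega)).2
        rw [if_pos (by omega), if_pos (by omega)]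
        ext ⟨u, v⟩
        simp only [mem_mv, Prod.mk.injEq, ne_eq]
        constructor
        · rintro (⟨rfl, rfl⟩ | ⟨h, ⟨rfl, rfl⟩ | h'⟩)
          · simp
          · simp at h
          · right
            refine ⟨?_, Or.inr ⟨h'.1, h'.2⟩⟩
            rintro ⟨rfl, rfl⟩
            exact p2 h'.2
        · rintro (⟨rfl, rfl⟩ | ⟨h, ⟨rfl, rfl⟩ | h'⟩)
          · simp
          · simp at h
          · right
            refine ⟨?_, Or.inr ⟨h'.1, h'.2⟩⟩
            rintro ⟨rfl, rfl⟩
            exact p4 h'.2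
      -- A single hole in the square: the two orders move different balls, but either way the hole
      -- travels to the diagonally opposite corner.
      · obtain rfl : s' = s + 1 := by omega
        have p5 := (hs'.mem_col (by omega)).1
        have p6 : (s + 1 + 1, x' + 1) ∈ M := by
          rcases mem_mv.1 p5 with h | h
          · simp at h
          · exact h.2
        rw [if_pos (by omega), if_pos (by omega)]
        ext ⟨u, v⟩
        simp only [mem_mv, Prod.mk.injEq, ne_eq]
        constructor
        · rintro (⟨rfl, rfl⟩ | ⟨h, ⟨rfl, rfl⟩ | h'⟩)
          · exact Or.inr ⟨by omega, Or.inr ⟨by omega, p3⟩⟩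
          · exact Or.inr ⟨by omega, Or.inl (by omega)⟩
          · by_cases h3 : u = s + 1 + 1 ∧ v = x' + 2
            · exact Or.inl h3
            · exact Or.inr ⟨h, Or.inr ⟨h3, h'.2⟩⟩
        · rintro (⟨rfl, rfl⟩ | ⟨h, ⟨rfl, rfl⟩ | h'⟩)
          · exact Or.inr ⟨by omega, Or.inr ⟨by omega, p1⟩⟩
          · exact Or.inr ⟨by omega, Or.inl (by omega)⟩
          · by_cases h3 : u = s + 1 ∧ v = x' + 1
            · exact Or.inl h3
            · exact Or.inr ⟨h, Or.inr ⟨h3, h'.2⟩⟩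
      · obtain rfl : s' = s := by omega
        rw [if_pos (by omega), if_pos (by omega)]
        have q1 : ¬((s' + 1, i + 1) = (j + 1, x' + 1)) := fun h => p2 (h ▸ p3)
        have q2 : ¬((j + 2, x' + 1) = (s' + 1, i + 2)) := fun h => p4 (h ▸ p1)
        simp only [Prod.mk.injEq] at q1 q2
        ext ⟨u, v⟩
        simp only [mem_mv, Prod.mk.injEq, ne_eq]
        by_cases hm : (u, v) ∈ M <;> simp only [hm, and_true, and_false, or_false] <;> omega
    · rw [if_neg hxn, fRight_eq hi1 hi hs, if_pos hsL, if_neg]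
      omega
  · rw [if_neg hsL, eDown_eq hj1 hj hx]
    by_cases hxn : x < n
    · obtain ⟨s', hs', -, h2⟩ := lastMax_col_mv hx hs hj hi hxn
      rw [if_pos hxn, fRight_eq hi1 hi hs', if_neg]
      omega
    · rw [if_neg hxn, fRight_eq hi1 hi hs, if_neg hsL]

end

/-! ### Raising operators, vertical maps and highest weight configurations -/

/-- The operator that moves one ball from row `j` to row `j + 1`, inverse to the dropping
operator. -/
noncomputable def fUp (n j : ℕ) (M : Config) : Config :=
  if (exists_firstMax (rowBal M j) n).choose = 0 then M
  else mv M (j, (exists_firstMax (rowBal M j) n).choose)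
    (j + 1, (exists_firstMax (rowBal M j) n).choose)

theorem fUp_eq {n j x : ℕ} {M : Config} (h : FirstMax (rowBal M j) n x) :
    fUp n j M = if x = 0 then M else mv M (j, x) (j + 1, x) := by
  unfold fUp
  rw [(exists_firstMax (rowBal M j) n).choose_spec.unique h]

theorem mv_mv_cancel {M : Config} {s t : ℕ × ℕ} (hs : s ∈ M) (ht : t ∉ M) :
    mv (mv M s t) t s = M := by
  ext u
  simp only [mem_mv]
  constructor
  · rintro (rfl | ⟨h1, h2 | h2⟩)
    · exact hs
    · exact absurd h2 h1
    · exact h2.2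
  · intro hu
    by_cases h : u = s
    · exact Or.inl h
    · refine Or.inr ⟨?_, Or.inr ⟨h, hu⟩⟩
      rintro rfl
      exact ht hu

theorem rowBal_mv_vert {M : Config} {a b c j : ℕ} (h1 : (a, c) ∈ M) (h2 : (b, c) ∉ M) (y : ℕ) :
    rowBal (mv M (a, c) (b, c)) j y = rowBal M j y +
      if c ≤ y then (if b = j then 1 else 0) - (if a = j then 1 else 0) -
        (if b = j + 1 then 1 else 0) + (if a = j + 1 then 1 else 0) else 0 := by
  unfold rowBal
  rw [pre_row_mv h1 h2, pre_row_mv h1 h2]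
  simp only
  split_ifs <;> omega

theorem firstMax_mv_down {M : Config} {n j x : ℕ} (h : LastMax (rowBal M j) n x) (hx : x < n) :
    FirstMax (rowBal (mv M (j + 1, x + 1) (j, x + 1)) j) n (x + 1) := by
  obtain ⟨m1, m2⟩ := h.mem_row hx
  have e := rowBal_succ M j x
  rw [if_neg m2, if_pos m1] at e
  refine ⟨hx, fun y hy => ?_⟩
  rw [rowBal_mv_vert m1 m2, rowBal_mv_vert m1 m2]
  have := h.2 y hy
  split_ifs <;> omega

theorem lastMax_mv_up {M : Config} {n j x : ℕ} (h : FirstMax (rowBal M j) n (x + 1)) :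
    LastMax (rowBal (mv M (j, x + 1) (j + 1, x + 1)) j) n x := by
  obtain ⟨m1, m2⟩ := h.mem_row
  have e := rowBal_succ M j x
  rw [if_neg m2, if_pos m1] at e
  refine ⟨by have := h.1; omega, fun y hy => ?_⟩
  rw [rowBal_mv_vert m1 m2, rowBal_mv_vert m1 m2]
  have := h.2 y hy
  split_ifs <;> omega

theorem fUp_eDown {L n j x : ℕ} {M : Config} (h1 : 1 ≤ j) (hj : j < L)
    (h : LastMax (rowBal M j) n x) (hx : x < n) : fUp n j (eDown L n j M) = M := by
  rw [eDown_eq h1 hj h, if_pos hx, fUp_eq (firstMax_mv_down h hx), if_neg (by omega)]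
  exact mv_mv_cancel (h.mem_row hx).1 (h.mem_row hx).2

theorem eDown_fUp {L n j x : ℕ} {M : Config} (h1 : 1 ≤ j) (hj : j < L)
    (h : FirstMax (rowBal M j) n (x + 1)) : eDown L n j (fUp n j M) = M := by
  rw [fUp_eq h, if_neg (by omega), eDown_eq h1 hj (lastMax_mv_up h), if_pos (Nat.lt_of_succ_le h.1)]
  exact mv_mv_cancel h.mem_row.1 h.mem_row.2

/-- The dropping operator with index `j` acts trivially. -/
def LowHw (n : ℕ) (M : Config) (j : ℕ) : Prop := ∀ x ≤ n, rowBal M j x ≤ rowBal M j n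

/-- `M` is a highest weight element for the column operators. -/
def ColHw (L n : ℕ) (M : Config) : Prop := ∀ i, 1 ≤ i → i < n → ∀ s ≤ L, colBal M i s ≤ 0

theorem lowHw_iff {n j x : ℕ} {M : Config} (h : LastMax (rowBal M j) n x) :
    LowHw n M j ↔ rowBal M j x = rowBal M j n :=
  ⟨fun h' => le_antisymm (h' x h.1) (h.2 n le_rfl).1, fun h' y hy => h' ▸ (h.2 y hy).1⟩

theorem lowHw_iff_eq {n j x : ℕ} {M : Config} (h : LastMax (rowBal M j) n x) :
    LowHw n M j ↔ x = n := by
  rw [lowHw_iff h]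
  refine ⟨fun h' => ?_, fun h' => by rw [h']⟩
  by_contra hne
  have := (h.2 n le_rfl).2 (lt_of_le_of_ne h.1 hne)
  omega

section

variable {L n i j : ℕ} {M : Config}

theorem rowBal_fRight_of_ne (hi1 : 1 ≤ i) (hi : i < n) (M : Config) (j : ℕ) {y : ℕ} (hy : y ≠ i) :
    rowBal (fRight L n i M) j y = rowBal M j y := by
  obtain ⟨s, hs⟩ := exists_lastMax (colBal M i) L
  rw [fRight_eq hi1 hi hs]
  split_ifs with h
  · rw [rowBal_mv_right (hs.mem_col h).1 (hs.mem_col h).2, if_neg hy, add_zero]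
  · rfl

theorem lastMax_fRight (hj1 : 1 ≤ j) (hj : j < L) (hi1 : 1 ≤ i) (hi : i < n) {x : ℕ}
    (hx : LastMax (rowBal M j) n x) :
    ∃ x', LastMax (rowBal (fRight L n i M) j) n x' ∧
      rowBal (fRight L n i M) j x' = rowBal M j x := by
  obtain ⟨j, rfl⟩ : ∃ k, j = k + 1 := ⟨j - 1, by omega⟩
  obtain ⟨i, rfl⟩ : ∃ k, i = k + 1 := ⟨i - 1, by omega⟩
  obtain ⟨s, hs⟩ := exists_lastMax (colBal M (i + 1)) L
  rw [fRight_eq hi1 hi hs]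
  split_ifs with h
  · obtain ⟨x', h1, h2, -⟩ := lastMax_row_mv hx hs hj hi h
    exact ⟨x', h1, h2⟩
  · exact ⟨x, hx, rfl⟩

theorem lastMax_eDown (hj1 : 1 ≤ j) (hj : j < L) (hi1 : 1 ≤ i) (hi : i < n) {s : ℕ}
    (hs : LastMax (colBal M i) L s) :
    ∃ s', LastMax (colBal (eDown L n j M) i) L s' ∧
      colBal (eDown L n j M) i s' = colBal M i s := by
  obtain ⟨j, rfl⟩ : ∃ k, j = k + 1 := ⟨j - 1, by omega⟩
  obtain ⟨i, rfl⟩ : ∃ k, i = k + 1 := ⟨i - 1, by omega⟩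
  obtain ⟨x, hx⟩ := exists_lastMax (rowBal M (j + 1)) n
  rw [eDown_eq hj1 hj hx]
  split_ifs with h
  · obtain ⟨s', h1, h2, -⟩ := lastMax_col_mv hx hs hj hi h
    exact ⟨s', h1, h2⟩
  · exact ⟨s, hs, rfl⟩

/-- The maximum of the row balance is preserved, and its value at `n` is untouched because `i < n`.
-/
theorem lowHw_fRight (hj1 : 1 ≤ j) (hj : j < L) (hi1 : 1 ≤ i) (hi : i < n) :
    LowHw n (fRight L n i M) j ↔ LowHw n M j := by
  obtain ⟨x, hx⟩ := exists_lastMax (rowBal M j) n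
  obtain ⟨x', hx', e⟩ := lastMax_fRight hj1 hj hi1 hi hx
  rw [lowHw_iff hx, lowHw_iff hx', e, rowBal_fRight_of_ne hi1 hi M j (by omega)]

/-- The highest weight condition bounds the maxima of the column balances, and a drop preserves
these maxima. -/
theorem colHw_eDown (hj1 : 1 ≤ j) (hj : j < L) :
    ColHw L n (eDown L n j M) ↔ ColHw L n M := by
  refine forall_congr' fun i => forall_congr' fun hi1 => forall_congr' fun hi => ?_
  obtain ⟨s, hs⟩ := exists_lastMax (colBal M i) L
  obtain ⟨s', hs', e⟩ := lastMax_eDown hj1 hj hi1 hi hs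
  constructor
  · intro h t ht
    have := h s' hs'.1
    have := (hs.2 t ht).1
    omega
  · intro h t ht
    have := h s hs.1
    have := (hs'.2 t ht).1
    omega

theorem colHw_fUp (hj1 : 1 ≤ j) (hj : j < L) (h : ColHw L n M) : ColHw L n (fUp n j M) := by
  obtain ⟨x, hx⟩ := exists_firstMax (rowBal M j) n
  rcases x with _ | x
  · rwa [fUp_eq hx, if_pos rfl]
  · rw [← colHw_eDown hj1 hj, eDown_fUp hj1 hj hx]
    exact h

theorem fUp_fRight_comm (M : Config) (hj1 : 1 ≤ j) (hj : j < L) (hi1 : 1 ≤ i) (hi : i < n) :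
    fUp n j (fRight L n i M) = fRight L n i (fUp n j M) := by
  obtain ⟨x, hx⟩ := exists_firstMax (rowBal M j) n
  rcases x with _ | x
  · rw [fUp_eq hx, if_pos rfl]
    obtain ⟨z, hz⟩ := exists_lastMax (rowBal M j) n
    obtain ⟨z', hz', e⟩ := lastMax_fRight hj1 hj hi1 hi hz
    rw [fUp_eq (x := 0), if_pos rfl]
    refine ⟨by omega, fun y hy => ⟨?_, by omega⟩⟩
    rw [rowBal_fRight_of_ne (y := 0) hi1 hi M j (by omega)]
    have := (hz'.2 y hy).1
    have := (hx.2 z hz.1).1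
    omega
  -- Writing `M` as a drop of `Z` reduces the claim to the commutation of drops. It remains that the
  -- drop stays effective after the column step, so that raising undoes it.
  · have h1 := eDown_fUp hj1 hj hx
    generalize hZ : fUp n j M = Z at h1 ⊢
    have hZ' : LastMax (rowBal Z j) n x := by
      rw [← hZ, fUp_eq hx, if_neg (by omega)]
      exact lastMax_mv_up hx
    have hxn := hx.1
    rw [← h1, ← eDown_fRight_comm Z hj1 hj hi1 hi]
    obtain ⟨x', hx', e⟩ := lastMax_fRight hj1 hj hi1 hi hZ'
    have hx'n : x' < n := by
      by_contra hcon
      have h2 : LowHw n (fRight L n i Z) j := (lowHw_iff_eq hx').2 (by have := hx'.1; omega)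
      rw [lowHw_fRight hj1 hj hi1 hi, lowHw_iff_eq hZ'] at h2
      omega
    exact fUp_eDown hj1 hj hx' hx'n

theorem eDown_subset (hM : M ⊆ box L n) (hj1 : 1 ≤ j) (hj : j < L) : eDown L n j M ⊆ box L n := by
  obtain ⟨x, hx⟩ := exists_lastMax (rowBal M j) n
  rw [eDown_eq hj1 hj hx]
  split_ifs with h
  · exact mv_subset hM (by simp; omega)
  · exact hM

theorem fUp_subset (hM : M ⊆ box L n) (hj : j < L) : fUp n j M ⊆ box L n := by
  obtain ⟨x, hx⟩ := exists_firstMax (rowBal M j) n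
  rw [fUp_eq hx]
  have := hx.1
  split_ifs with h
  · exact hM
  · exact mv_subset hM (by simp; omega)

theorem fRight_subset (hM : M ⊆ box L n) (hi1 : 1 ≤ i) (hi : i < n) :
    fRight L n i M ⊆ box L n := by
  obtain ⟨s, hs⟩ := exists_lastMax (colBal M i) L
  rw [fRight_eq hi1 hi hs]
  split_ifs with h
  · exact mv_subset hM (by simp; omega)
  · exact hM

theorem rowCard_fRight (hi1 : 1 ≤ i) (hi : i < n) (M : Config) (r : ℕ) :
    rowCard (fRight L n i M) r = rowCard M r := by
  obtain ⟨s, hs⟩ := exists_lastMax (colBal M i) L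
  rw [fRight_eq hi1 hi hs]
  split_ifs with h
  · have := rowCard_mv (hs.mem_col h).1 (hs.mem_col h).2 r
    simp only at this
    split_ifs at this <;> omega
  · rfl

theorem card_fRight (hi1 : 1 ≤ i) (hi : i < n) (M : Config) : (fRight L n i M).card = M.card := by
  obtain ⟨s, hs⟩ := exists_lastMax (colBal M i) L
  rw [fRight_eq hi1 hi hs]
  split_ifs with h
  · exact card_mv (hs.mem_col h).1 (hs.mem_col h).2
  · rfl

theorem pre_col_eDown (hj1 : 1 ≤ j) (hj : j < L) (M : Config) (c : ℕ) {t : ℕ} (ht : t ≠ j) :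
    pre (col (eDown L n j M) c) t = pre (col M c) t := by
  obtain ⟨x, hx⟩ := exists_lastMax (rowBal M j) n
  rw [eDown_eq hj1 hj hx]
  split_ifs with h
  · rw [pre_col_mv (hx.mem_row h).1 (hx.mem_row h).2]
    simp only
    split_ifs <;> omega
  · rfl

theorem pre_col_fUp (M : Config) (c : ℕ) {t : ℕ} (ht : t ≠ j) :
    pre (col (fUp n j M) c) t = pre (col M c) t := by
  obtain ⟨x, hx⟩ := exists_firstMax (rowBal M j) n
  rw [fUp_eq hx]
  split_ifs with h
  · rfl
  · obtain ⟨x, rfl⟩ : ∃ k, x = k + 1 := ⟨x - 1, by omega⟩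
    rw [pre_col_mv hx.mem_row.1 hx.mem_row.2]
    simp only
    split_ifs <;> omega

theorem row_mv_of_ne (M : Config) {s t : ℕ × ℕ} {r : ℕ} (h1 : s.1 ≠ r) (h2 : t.1 ≠ r) :
    row (mv M s t) r = row M r := by
  ext c
  simp only [mem_row, mem_mv]
  constructor
  · rintro (rfl | h)
    · exact absurd rfl h2
    · exact h.2
  · intro h
    refine Or.inr ⟨?_, h⟩
    rintro rfl
    exact h1 rfl

theorem row_eDown_of_ne (hj1 : 1 ≤ j) (hj : j < L) (M : Config) {r : ℕ} (h1 : r ≠ j)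
    (h2 : r ≠ j + 1) : row (eDown L n j M) r = row M r := by
  obtain ⟨x, hx⟩ := exists_lastMax (rowBal M j) n
  rw [eDown_eq hj1 hj hx]
  split_ifs with h
  · exact row_mv_of_ne M (fun h => h2 h.symm) (fun h => h1 h.symm)
  · rfl

theorem row_fUp_of_ne (M : Config) {r : ℕ} (h1 : r ≠ j)
    (h2 : r ≠ j + 1) : row (fUp n j M) r = row M r := by
  obtain ⟨x, hx⟩ := exists_firstMax (rowBal M j) n
  rw [fUp_eq hx]
  split_ifs with h
  · rfl
  · exact row_mv_of_ne M (fun h => h1 h.symm) (fun h => h2 h.symm)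

end

/-- A map on configurations on the `L × n` array that commutes with the column operators and keeps
the number of balls in each column. -/
structure IsVertical (L n : ℕ) (Φ : Config → Config) : Prop where
  subset : ∀ {M}, M ⊆ box L n → Φ M ⊆ box L n
  comm : ∀ {M i}, M ⊆ box L n → 1 ≤ i → i < n → Φ (fRight L n i M) = fRight L n i (Φ M)
  col : ∀ {M}, M ⊆ box L n → ∀ c, pre (col (Φ M) c) L = pre (col M c) L
  colHw : ∀ {M}, M ⊆ box L n → ColHw L n M → ColHw L n (Φ M)

/-! ### Calculus of vertical maps -/

namespace IsVertical

variable {L n : ℕ} {Φ Ψ : Config → Config}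

theorem id : IsVertical L n fun M => M :=
  ⟨fun h => h, fun _ _ _ => rfl, fun _ _ => rfl, fun _ h => h⟩

theorem comp (hΦ : IsVertical L n Φ) (hΨ : IsVertical L n Ψ) : IsVertical L n fun M => Φ (Ψ M) where
  subset h := hΦ.subset (hΨ.subset h)
  comm h hi1 hi := by
    rw [hΨ.comm h hi1 hi, hΦ.comm (hΨ.subset h) hi1 hi]
  col h c := by rw [hΦ.col (hΨ.subset h), hΨ.col h]
  colHw h h' := hΦ.colHw (hΨ.subset h) (hΨ.colHw h h')

theorem iterate (hΦ : IsVertical L n Φ) (k : ℕ) : IsVertical L n fun M => Φ^[k] M := by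
  induction k with
  | zero => exact IsVertical.id
  | succ k ih =>
    simp only [Function.iterate_succ', Function.comp]
    exact hΦ.comp ih

theorem eDown {j : ℕ} (hj1 : 1 ≤ j) (hj : j < L) : IsVertical L n (eDown L n j) where
  subset h := eDown_subset h hj1 hj
  comm _ hi1 hi := eDown_fRight_comm _ hj1 hj hi1 hi
  col _ c := pre_col_eDown hj1 hj _ c (by omega)
  colHw _ h := (colHw_eDown hj1 hj).2 h

theorem fUp {j : ℕ} (hj1 : 1 ≤ j) (hj : j < L) : IsVertical L n (fUp n j) where
  subset h := fUp_subset h hj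
  comm _ hi1 hi := fUp_fRight_comm _ hj1 hj hi1 hi
  col _ c := pre_col_fUp _ c (by omega)
  colHw _ h := colHw_fUp hj1 hj h

theorem eDownStar {j : ℕ} (hj1 : 1 ≤ j) (hj : j < L) : IsVertical L n (eDownStar L n j) where
  subset {M} h := ((IsVertical.eDown hj1 hj).iterate M.card).subset h
  comm {M i} h hi1 hi := by
    unfold MultilineQueue.eDownStar
    -- The number of iterations depends on the configuration, but only through its number of balls.
    rw [card_fRight hi1 hi]
    exact ((IsVertical.eDown hj1 hj).iterate M.card).comm h hi1 hi
  col {M} h c := ((IsVertical.eDown hj1 hj).iterate M.card).col h c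
  colHw {M} h h' := ((IsVertical.eDown hj1 hj).iterate M.card).colHw h h'

theorem sweep {k : ℕ} (hk : k < L) : IsVertical L n (sweep L n k) := by
  induction k with
  | zero => exact IsVertical.id
  | succ k ih => exact (ih (by omega)).comp (IsVertical.eDownStar (by omega) hk)

theorem stage {k : ℕ} (hk : k = 0 ∨ k < L) : IsVertical L n fun M => stage L n M k := by
  induction k with
  | zero => exact IsVertical.id
  | succ k ih => exact (IsVertical.sweep (by omega)).comp (ih (by omega))

theorem collapse : IsVertical L n (collapse L n) := IsVertical.stage (by omega)

/-- Vertical maps that agree on `M` agree on what is reached from `M` by column operators. -/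
theorem eq_of_reach (hΦ : IsVertical L n Φ) (hΨ : IsVertical L n Ψ) {A B : Config}
    (hA : A ⊆ box L n)
    (h : Relation.ReflTransGen (fun A B => ∃ i, 1 ≤ i ∧ i < n ∧ fRight L n i A = B) A B)
    (e : Φ A = Ψ A) : Φ B = Ψ B := by
  suffices B ⊆ box L n ∧ Φ B = Ψ B from this.2
  induction h with
  | refl => exact ⟨hA, e⟩
  | tail _ h ih =>
    obtain ⟨i, hi1, hi, rfl⟩ := h
    exact ⟨fRight_subset ih.1 hi1 hi, by rw [hΦ.comm ih.1 hi1 hi, hΨ.comm ih.1 hi1 hi, ih.2]⟩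

end IsVertical

/-! ### Highest weight elements and invariants of components -/

theorem sum_mv {M : Config} {s t : ℕ × ℕ} (hs : s ∈ M) (ht : t ∉ M) (w : ℕ × ℕ → ℕ) :
    ∑ u ∈ mv M s t, w u + w s = ∑ u ∈ M, w u + w t := by
  unfold mv
  rw [Finset.sum_insert (by simp [ht]), add_assoc, Finset.sum_erase_add _ _ hs, add_comm]

/-- Each configuration is reached from a highest weight configuration by column operators. -/
theorem exists_colHw {L n : ℕ} {M : Config} (hM : M ⊆ box L n) :
    ∃ A, A ⊆ box L n ∧ ColHw L n A ∧
      Relation.ReflTransGen (fun A B => ∃ i, 1 ≤ i ∧ i < n ∧ fRight L n i A = B) A M := by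
  induction hw : ∑ u ∈ M, u.2 using Nat.strong_induction_on generalizing M with
  | _ w ih =>
    by_cases h : ColHw L n M
    · exact ⟨M, hM, h, .refl⟩
    · unfold ColHw at h
      push Not at h
      obtain ⟨i, hi1, hi, s, hs, hpos⟩ := h
      -- The first maximum locates the ball whose move to the left is undone by the column operator;
      -- that move lowers the sum of the column numbers.
      obtain ⟨t, ht⟩ := exists_firstMax (colBal M i) L
      rcases t with _ | t
      · have := (ht.2 s hs).1
        rw [colBal_zero hM] at this
        omega
      have h1 := (ht.2 t (by have := ht.1; omega)).2 (by omega)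
      have e := colBal_succ M i t
      have hm : (t + 1, i + 1) ∈ M ∧ (t + 1, i) ∉ M := by
        split_ifs at e <;> first | omega | exact ⟨by assumption, by assumption⟩
      obtain ⟨m1, m2⟩ := hm
      rw [if_neg m2, if_pos m1] at e
      have ec : ∀ y, colBal (mv M (t + 1, i + 1) (t + 1, i)) i y =
          colBal M i y - if t + 1 ≤ y then 2 else 0 := by
        intro y
        unfold colBal
        rw [pre_col_mv m1 m2, pre_col_mv m1 m2]
        simp only [true_and]
        split_ifs <;> omega
      have hmax : LastMax (colBal (mv M (t + 1, i + 1) (t + 1, i)) i) L t := by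
        refine ⟨by have := ht.1; omega, fun y hy => ?_⟩
        have h2 := ht.2 y hy
        rw [ec, ec]
        split_ifs <;> omega
      have hf : fRight L n i (mv M (t + 1, i + 1) (t + 1, i)) = M := by
        rw [fRight_eq hi1 hi hmax, if_pos (Nat.lt_of_succ_le ht.1)]
        exact mv_mv_cancel m1 m2
      have hsub : mv M (t + 1, i + 1) (t + 1, i) ⊆ box L n :=
        mv_subset hM (by have := ht.1; simp; omega)
      have hsum := sum_mv m1 m2 Prod.snd
      obtain ⟨A, hA, hA', hr⟩ := ih _ (by simp only at hsum; omega) hsub rfl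
      exact ⟨A, hA, hA', hr.tail ⟨i, hi1, hi, hf⟩⟩

/-- An invariant of the column operators is constant on the components of the crystal graph. -/
theorem MLQ.SameComponent.invariant {lam : YoungDiagram} {n : ℕ} {M M' : MLQ lam n}
    (h : M.SameComponent M') {β : Sort*} (P : Config → β)
    (hP : ∀ A ⊆ box (height lam) n, ∀ i, 1 ≤ i → i < n → P (fRight (height lam) n i A) = P A) :
    P M.1 = P M'.1 := by
  induction h with
  | rel A B h =>
    obtain ⟨i, hi1, hi, e⟩ := h
    rw [← e, hP _ A.2.1 i hi1 hi]
  | refl => rfl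
  | symm _ _ _ ih => exact ih.symm
  | trans _ _ _ _ _ ih1 ih2 => exact ih1.trans ih2

theorem IsVertical.rowCard_eq {lam : YoungDiagram} {n : ℕ} {M M' : MLQ lam n}
    (h : M.SameComponent M') {Φ : Config → Config} (hΦ : IsVertical (height lam) n Φ) (r : ℕ) :
    rowCard (Φ M.1) r = rowCard (Φ M'.1) r :=
  h.invariant (fun A => rowCard (Φ A) r) fun A hA i hi1 hi => by
    rw [hΦ.comm hA hi1 hi, rowCard_fRight hi1 hi]

theorem IsVertical.lowHw_iff {lam : YoungDiagram} {n j : ℕ} {M M' : MLQ lam n}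
    (h : M.SameComponent M') {Φ : Config → Config} (hΦ : IsVertical (height lam) n Φ)
    (hj1 : 1 ≤ j) (hj : j < height lam) : LowHw n (Φ M.1) j = LowHw n (Φ M'.1) j :=
  h.invariant (fun A => LowHw n (Φ A) j) fun A hA i hi1 hi => by
    rw [hΦ.comm hA hi1 hi, lowHw_fRight hj1 hj hi1 hi]

/-! ### Queues -/

theorem pre_zero_eq (A : Finset ℕ) : pre A 0 = if 0 ∈ A then 1 else 0 := by
  split_ifs with h
  · unfold pre
    have : A.filter (· ≤ 0) = {0} := by
      ext y
      simp only [Finset.mem_filter, Nat.le_zero, Finset.mem_singleton]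
      exact ⟨fun h => h.2, fun e => ⟨e ▸ h, e⟩⟩
    rw [this]
    simp
  · exact pre_zero h

theorem pre_ext {A B : Finset ℕ} (h : ∀ x, pre A x = pre B x) : A = B := by
  ext c
  rcases c with _ | c
  · have h0 := h 0
    rw [pre_zero_eq, pre_zero_eq] at h0
    split_ifs at h0 <;> simp_all
  · have h1 := h (c + 1)
    rw [pre_succ, pre_succ, h c] at h1
    split_ifs at h1 <;> simp_all

theorem pre_sub_le {K A : Finset ℕ} (h : K ⊆ A) {x y : ℕ} (hxy : x ≤ y) :
    pre K y - pre K x ≤ pre A y - pre A x := by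
  induction y, hxy using Nat.le_induction with
  | base => simp
  | succ y _ ih =>
    rw [pre_succ, pre_succ]
    by_cases hk : y + 1 ∈ K
    · rw [if_pos hk, if_pos (h hk)]; omega
    · rw [if_neg hk]
      split_ifs <;> omega

theorem pre_le_of_subset {K A : Finset ℕ} (h : K ⊆ A) (x : ℕ) : pre K x ≤ pre A x := by
  unfold pre
  exact_mod_cast Finset.card_le_card (Finset.filter_subset_filter _ h)

theorem pre_sub_eq {K A : Finset ℕ} {x y : ℕ} (hxy : x ≤ y)
    (h : ∀ a, x < a → a ≤ y → (a ∈ K ↔ a ∈ A)) : pre K y - pre K x = pre A y - pre A x := by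
  induction y, hxy using Nat.le_induction with
  | base => simp
  | succ y hy ih =>
    rw [pre_succ, pre_succ]
    have := ih fun a h1 h2 => h a h1 (by omega)
    simp only [h (y + 1) (by omega) le_rfl]
    omega

theorem pre_eq_of {K A : Finset ℕ} {x : ℕ} (h : ∀ a ≤ x, (a ∈ K ↔ a ∈ A)) : pre K x = pre A x := by
  unfold pre
  congr 2
  ext a
  simp only [Finset.mem_filter]
  exact ⟨fun ⟨h1, h2⟩ => ⟨(h a h2).1 h1, h2⟩, fun ⟨h1, h2⟩ => ⟨(h a h2).2 h1, h2⟩⟩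

theorem pre_insert {A : Finset ℕ} {c : ℕ} (h : c ∉ A) (x : ℕ) :
    pre (insert c A) x = pre A x + if c ≤ x then 1 else 0 := by
  unfold pre
  rw [Finset.filter_insert]
  split_ifs
  · rw [Finset.card_insert_of_notMem (by simp [h])]
    push_cast; ring
  · simp

theorem pre_erase {A : Finset ℕ} {c : ℕ} (h : c ∈ A) (x : ℕ) :
    pre (A.erase c) x = pre A x - if c ≤ x then 1 else 0 := by
  have := pre_insert (Finset.notMem_erase c A) x
  rw [Finset.insert_erase h] at this
  omega

theorem pre_pred {A : Finset ℕ} {b : ℕ} (h : b ∈ A) {x : ℕ} (hx : x < b) :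
    pre A x ≤ pre A b - 1 := by
  obtain ⟨c, rfl⟩ : ∃ c, b = c + 1 := ⟨b - 1, by omega⟩
  have := pre_succ A c
  rw [if_pos h] at this
  have := pre_mono A (show x ≤ c by omega)
  omega

/-- `K` is the set of those balls of `A` that are paired when the balls of `P`, together with `t`
further balls on the far left, are paired with the balls of `A` weakly to their right. -/
structure Pairing (P A K : Finset ℕ) (t : ℤ) : Prop where
  sub : K ⊆ A
  le : ∀ x, pre K x ≤ pre P x + t
  free : ∀ b ∈ A, b ∉ K → pre K b = pre P b + t

theorem last_free (A K : Finset ℕ) (x : ℕ) :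
    (∀ a ∈ A, a ≤ x → a ∈ K) ∨
      ∃ b ∈ A, b ∉ K ∧ b ≤ x ∧ ∀ a ∈ A, b < a → a ≤ x → a ∈ K := by
  by_cases h : ((A \ K).filter (· ≤ x)).Nonempty
  · right
    have hm := Finset.max'_mem _ h
    simp only [Finset.mem_filter, Finset.mem_sdiff] at hm
    refine ⟨_, hm.1.1, hm.1.2, hm.2, fun a ha h1 h2 => ?_⟩
    by_contra hk
    have := Finset.le_max' ((A \ K).filter (· ≤ x)) a (by simp [ha, hk, h2])
    omega
  · left
    intro a ha hx
    by_contra hk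
    exact h ⟨a, by simp [ha, hk, hx]⟩

/-! ### Comparison and transport of queues -/

namespace Pairing

variable {P P' A K K' : Finset ℕ} {t t' : ℤ}

/-- Past the last free site `b` up to `x`, all of `A` is used. Together with `upper` and `K ⊆ A`
this is the departure formula of a queue: `pre K x` is the minimum of `pre A x` and of `pre P y + t
+ pre A x - pre A y` over `y ≤ x`. Uniqueness and monotonicity follow. -/
theorem lower (h : Pairing P A K t) (x : ℕ) :
    (pre K x = pre A x) ∨
      ∃ b ∈ A, b ∉ K ∧ b ≤ x ∧ pre K x = pre P b + t + pre A x - pre A b := by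
  rcases last_free A K x with h1 | ⟨b, hb, hk, hx, h1⟩
  · exact Or.inl (pre_eq_of fun a ha => ⟨fun h' => h.sub h', fun h' => h1 a h' ha⟩)
  · refine Or.inr ⟨b, hb, hk, hx, ?_⟩
    have := pre_sub_eq (K := K) (A := A) hx
      fun a h2 h3 => ⟨fun h' => h.sub h', fun h' => h1 a h' h2 h3⟩
    have := h.free b hb hk
    omega

theorem upper (h : Pairing P A K t) {x y : ℕ} (hxy : y ≤ x) :
    pre K x ≤ pre P y + t + pre A x - pre A y := by
  have := h.le y
  have := pre_sub_le h.sub hxy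
  omega

theorem mono (h : Pairing P A K t) (h' : Pairing P' A K' t')
    (hP : ∀ y, pre P y + t ≤ pre P' y + t') (x : ℕ) : pre K x ≤ pre K' x := by
  rcases h'.lower x with e | ⟨b, hb, hk, hx, e⟩
  · rw [e]
    exact pre_le_of_subset h.sub x
  · have := h.upper hx
    have := hP b
    omega

theorem unique (h : Pairing P A K t) (h' : Pairing P A K' t) : K = K' :=
  pre_ext fun x => le_antisymm (h.mono h' (fun _ => le_rfl) x) (h'.mono h (fun _ => le_rfl) x)

/-- If `b` were used by `K` but free for `K'`, the larger queue would be exhausted at `b`. Counting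
from the last site `c` that `K` leaves free, the arrivals in `(c, b]` suffice to fill all of `A`
there, including `b`. -/
theorem subset (h : Pairing P A K t) (h' : Pairing P' A K' t') (hP : P ⊆ P') (ht : t ≤ t') :
    K ⊆ K' := by
  intro b hb
  by_contra hk
  have hbA := h.sub hb
  have e1 := h'.free b hbA hk
  rcases h.lower b with e | ⟨c, hc, hcK, hcb, e⟩
  · have h1 := h.le b
    have h2 := pre_le_of_subset hP b
    have h3 := pre_le_of_subset (K := insert b K') (A := A)
      (Finset.insert_subset hbA h'.sub) b
    rw [pre_insert hk, if_pos le_rfl] at h3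
    omega
  · have h1 := h.le b
    have h2 := pre_sub_le hP hcb
    have h4 : c < b := lt_of_le_of_ne hcb fun h => hcK (h ▸ hb)
    have h3 := pre_sub_le (K := insert b K') (A := A) (Finset.insert_subset hbA h'.sub) hcb
    rw [pre_insert hk, pre_insert hk, if_pos le_rfl, if_neg (by omega)] at h3
    have h5 := h'.le c
    omega

/-- The solutions are nested as `t` grows, so the size of `K` makes the number of wrapped balls
irrelevant. This is what makes cyclic pairing well defined. -/
theorem unique_of_card (h : Pairing P A K t) (h' : Pairing P A K' t') (hc : K.card = K'.card) :
    K = K' := by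
  rcases le_total t t' with ht | ht
  · exact Finset.eq_of_subset_of_card_le (h.subset h' subset_rfl ht) hc.ge
  · exact (Finset.eq_of_subset_of_card_le (h'.subset h subset_rfl ht) hc.le).symm

/-- Greedy service from left to right: a new rightmost site is used exactly when some ball is still
waiting. -/
theorem exists_of_nonneg (P A : Finset ℕ) {t : ℤ} (ht : 0 ≤ t) : ∃ K, Pairing P A K t := by
  induction A using Finset.induction_on_max with
  | empty =>
    refine ⟨∅, subset_rfl, fun x => ?_, by simp⟩
    have := pre_nonneg P x
    have : pre ∅ x = 0 := by simp [pre]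
    omega
  | insert b A hb ih =>
    obtain ⟨K, h⟩ := ih
    have hbK : b ∉ K := fun h' => lt_irrefl _ (hb b (h.sub h'))
    by_cases hc : pre K b < pre P b + t
    · refine ⟨insert b K, Finset.insert_subset_insert _ h.sub, fun x => ?_, fun a ha hak => ?_⟩
      · rw [pre_insert hbK]
        split_ifs with hx
        · have e : pre K x - pre K b = pre ∅ x - pre ∅ b := by
            refine pre_sub_eq hx fun a h1 h2 => ?_
            simp only [Finset.notMem_empty, iff_false]
            intro h3
            have := hb a (h.sub h3)
            omega
          have := pre_mono P hx
          have e1 : pre ∅ x = 0 := by simp [pre]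
          have e2 : pre ∅ b = 0 := by simp [pre]
          omega
        · have := h.le x
          omega
      · simp only [Finset.mem_insert, not_or] at ha hak
        have ha' := ha.resolve_left hak.1
        have := hb a ha'
        rw [pre_insert hbK, if_neg (by omega), h.free a ha' hak.2, add_zero]
    · refine ⟨K, h.sub.trans (Finset.subset_insert _ _), h.le, fun a ha hak => ?_⟩
      rcases Finset.mem_insert.1 ha with rfl | ha
      · have := h.le a
        omega
      · exact h.free a ha hak

/-- Replacing the arrivals by the sites where they are served without wrapping does not change the
pairing. Both sets of balls then lie in the same row, as `push` requires. -/
theorem self_of_subset (h : Pairing P A K t) (h' : Pairing P A K' 0) (ht : 0 ≤ t) :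
    Pairing K' A K t := by
  have key : ∀ x, pre K x ≤ pre K' x + t := by
    intro x
    rcases h'.lower x with e | ⟨b, hb, hk, hx, e⟩
    · have := pre_le_of_subset h.sub x
      omega
    · have := h.upper hx
      omega
  refine ⟨h.sub, key, fun b hb hk => le_antisymm (key b) ?_⟩
  have := h.free b hb hk
  have := h'.le b
  omega

/-- The queue operator maps adding the `t` leftmost balls to adding the `t` leftmost balls. -/
theorem push {N C S G H : Finset ℕ} (hPN : P ⊆ N) (hC : Pairing P N C t) (ht : 0 ≤ t)
    (hS : Pairing N A S 0) (hG : Pairing P A G 0) (hH : Pairing C A H 0) :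
    G ⊆ S ∧ Pairing G S H t := by
  have hHS : H ⊆ S := hH.subset hS hC.sub le_rfl
  have key : ∀ x, pre H x ≤ pre G x + t := by
    intro x
    rcases hG.lower x with e | ⟨b, hb, hk, hx, e⟩
    · have := pre_le_of_subset hH.sub x
      omega
    · have := hH.upper hx
      have := hC.le b
      omega
  refine ⟨hG.subset hS hPN le_rfl, hHS, key, fun b hb hk => le_antisymm (key b) ?_⟩
  have e1 := hH.free b (hS.sub hb) hk
  have e2 := hG.le b
  -- If `C` contains all of `N` up to `b`, then `insert b H ⊆ S` has too many elements. Otherwise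
  -- the queue of `P` in `N` is exhausted at `z`, and afterwards `C` agrees with `N ⊇ P`, so enough
  -- arrivals reach `b`.
  rcases last_free N C b with h1 | ⟨z, hz, hzC, hzb, h1⟩
  · exfalso
    have e3 : pre C b = pre N b := pre_eq_of fun a ha => ⟨fun h => hC.sub h, fun h => h1 a h ha⟩
    have h2 := hS.le b
    have h3 := pre_le_of_subset (K := insert b H) (A := S) (Finset.insert_subset hb hHS) b
    rw [pre_insert hk, if_pos le_rfl] at h3
    omega
  · have e3 := hC.free z hz hzC
    have e4 := pre_sub_eq (K := C) (A := N) hzb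
      fun a h2 h3 => ⟨fun h => hC.sub h, fun h => h1 a h h2 h3⟩
    have e5 := pre_sub_le hPN hzb
    omega

/-- Domination of the suffix counts means that every ball finds a partner weakly to its right, so
nothing has to wrap. -/
theorem card_eq {N : Finset ℕ} {n : ℕ} (h : Pairing P A K 0) (hPN : P ⊆ N)
    (hN : N ⊆ Finset.Icc 1 n) (hA : A ⊆ Finset.Icc 1 n)
    (hNA : ∀ x ≤ n, pre N n - pre N x ≤ pre A n - pre A x) : K.card = P.card := by
  have e1 := pre_of_le (h.sub.trans hA) (le_refl n)
  have e2 := pre_of_le (hPN.trans hN) (le_refl n)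
  have h1 := h.le n
  rcases h.lower n with e | ⟨b, hb, hk, hx, e⟩
  · have h2 := hNA 0 (by omega)
    rw [pre_zero (zero_notMem_of_subset hN), pre_zero (zero_notMem_of_subset hA)] at h2
    have := pre_le_of_subset hPN n
    omega
  · have h2 := hNA b hx
    have := pre_sub_le hPN hx
    omega

/-- Pairing one more ball, without wrapping. -/
theorem insert_right (h : Pairing P A K t) {c d : ℕ} (hc : c ∉ P) (hd : d ∈ A) (hdK : d ∉ K)
    (hcd : c ≤ d) (hno : ∀ a ∈ A, a ∉ K → c ≤ a → d ≤ a) :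
    Pairing (insert c P) A (insert d K) t := by
  refine ⟨Finset.insert_subset hd h.sub, fun x => ?_, fun b hb hk => ?_⟩
  · rw [pre_insert hc, pre_insert hdK]
    have := h.le x
    split_ifs <;> omega
  · simp only [Finset.mem_insert, not_or] at hk
    have h1 := h.free b hb hk.2
    have h2 := hno b hb hk.2
    rw [pre_insert hc, pre_insert hdK]
    split_ifs <;> omega

/-- Pairing one more ball, with wrapping. -/
theorem insert_wrap (h : Pairing P A K t) {c d : ℕ} (hc : c ∉ P) (hd : d ∈ A) (hdK : d ∉ K)
    (hno : ∀ a ∈ A, a ∉ K → a < c ∧ d ≤ a) :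
    Pairing (insert c P) A (insert d K) (t + 1) := by
  refine ⟨Finset.insert_subset hd h.sub, fun x => ?_, fun b hb hk => ?_⟩
  · rw [pre_insert hc, pre_insert hdK]
    have := h.le x
    split_ifs <;> omega
  · simp only [Finset.mem_insert, not_or] at hk
    have h1 := h.free b hb hk.2
    have h2 := hno b hb hk.2
    rw [pre_insert hc, pre_insert hdK]
    split_ifs <;> omega

/-- Removing the last paired ball of the virtual balls on the left. -/
theorem erase_firstMax {n x : ℕ} (h : Pairing P A K t) (hP : P ⊆ Finset.Icc 1 n)
    (hA : A ⊆ Finset.Icc 1 n) (htight : ∃ z ≤ n, pre K z = pre P z + t) (ht : 1 ≤ t)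
    {f : ℕ → ℤ} (hf : ∀ y, f y = 2 * pre K y - pre P y - pre A y) (hx : FirstMax f n x) :
    x ∈ K ∧ x ∉ P ∧ pre K x = pre P x + t ∧ Pairing P A (K.erase x) (t - 1) := by
  classical
  have hex : ∃ z, pre K z = pre P z + t := let ⟨z, _, h⟩ := htight; ⟨z, h⟩
  -- The point `d` is where the last waiting ball is first served. No site of `A` before it is free,
  -- so `K` agrees with `A` up to `d`. Since `f` is `K - P` minus the count of `A \ K`, its maximum
  -- is `t`, first attained at `d`.
  obtain ⟨d, hd, hmin⟩ : ∃ d, pre K d = pre P d + t ∧ ∀ y < d, pre K y ≠ pre P y + t :=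
    ⟨Nat.find hex, Nat.find_spec hex, fun y hy => Nat.find_min hex hy⟩
  have hdn : d ≤ n := by
    obtain ⟨z, hz, hz'⟩ := htight
    by_contra hc
    exact hmin z (by omega) hz'
  have h0 : d ≠ 0 := by
    rintro rfl
    rw [pre_zero (zero_notMem_of_subset hP), pre_zero (zero_notMem_of_subset (h.sub.trans hA))]
      at hd
    omega
  obtain ⟨e, rfl⟩ : ∃ e, d = e + 1 := ⟨d - 1, by omega⟩
  have hlt : ∀ y < e + 1, pre K y < pre P y + t := fun y hy => lt_of_le_of_ne (h.le y) (hmin y hy)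
  have he := hlt e (by omega)
  have hK1 := pre_succ K e
  have hP1 := pre_succ P e
  have hdK : e + 1 ∈ K ∧ e + 1 ∉ P := by
    split_ifs at hK1 hP1 <;> first | omega | exact ⟨by assumption, by assumption⟩
  have hKA : ∀ y ≤ e + 1, pre K y = pre A y := by
    intro y hy
    refine pre_eq_of fun a ha => ⟨fun h' => h.sub h', fun h' => ?_⟩
    by_contra hk
    have := h.free a h' hk
    rcases Nat.lt_or_ge a (e + 1) with h2 | h2
    · have := hlt a h2
      omega
    · exact hk (by rw [show a = e + 1 by omega]; exact hdK.1)
  have hmax : FirstMax f n (e + 1) := by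
    refine ⟨hdn, fun y hy => ?_⟩
    rw [hf, hf]
    have h1 := hKA (e + 1) le_rfl
    have h2 := h.le y
    have h3 := pre_le_of_subset h.sub y
    refine ⟨by omega, fun hy' => ?_⟩
    have := hlt y hy'
    omega
  obtain rfl := hx.unique hmax
  refine ⟨hdK.1, hdK.2, hd, (Finset.erase_subset _ _).trans h.sub, fun y => ?_, fun b hb hk => ?_⟩
  · rw [pre_erase hdK.1]
    have h2 := h.le y
    split_ifs with h1
    · omega
    · have := hlt y (by omega)
      omega
  · rw [pre_erase hdK.1]
    by_cases hbe : b = e + 1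
    · subst hbe
      rw [if_pos le_rfl]; omega
    · have hbK : b ∉ K := fun h' => hk (Finset.mem_erase.2 ⟨hbe, h'⟩)
      have h1 := h.free b hb hbK
      rw [if_pos]
      · omega
      · by_contra hc
        have := hlt b (by omega)
        omega

end Pairing

/-! ### Raising and dropping many balls -/

/-- Row `j` of `M` is the set `K` of paired balls of `B`, and the remaining balls of `B` are in
row `j + 1`, besides those of `S`. -/
structure Raised (n j : ℕ) (S B : Finset ℕ) (u : ℤ) (M : Config) : Prop where
  pairing : Pairing S B (row M j) u
  above : ∀ y, pre (row M (j + 1)) y = pre S y + pre B y - pre (row M j) y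
  tight : ∃ z ≤ n, pre (row M j) z = pre S z + u

theorem row_mv_source {M : Config} {a b c : ℕ} (hab : a ≠ b) :
    row (mv M (a, c) (b, c)) a = (row M a).erase c := by
  ext d
  simp only [mem_row, mem_mv, Finset.mem_erase, Prod.mk.injEq, ne_eq]
  constructor
  · rintro (h | h)
    · exact absurd h.1 hab
    · exact ⟨fun e => h.1 ⟨trivial, e⟩, h.2⟩
  · rintro ⟨h1, h2⟩
    exact Or.inr ⟨fun e => h1 e.2, h2⟩

section

variable {L n j : ℕ} {S B : Finset ℕ} {u : ℤ} {M : Config}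

/-- The row balance is `2 pre K - pre S - pre B`, so the raised ball is the one removed in
`Pairing.erase_firstMax`: raising takes away one virtual ball from the left. -/
theorem Raised.fUp (h : Raised n j S B u M) (hS : S ⊆ Finset.Icc 1 n) (hB : B ⊆ Finset.Icc 1 n)
    (hu : 1 ≤ u) :
    Raised n j S B (u - 1) (fUp n j M) ∧ (row (fUp n j M) j).card + 1 = (row M j).card := by
  obtain ⟨x, hx⟩ := exists_firstMax (rowBal M j) n
  obtain ⟨h1, h2, h3, h4⟩ := h.pairing.erase_firstMax hS hB h.tight hu
    (fun y => by unfold rowBal; rw [h.above]; ring) hx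
  have hx0 : x ≠ 0 := by
    rintro rfl
    exact zero_notMem_of_subset (h.pairing.sub.trans hB) h1
  obtain ⟨x, rfl⟩ : ∃ k, x = k + 1 := ⟨x - 1, by omega⟩
  have hm := hx.mem_row
  have hr : row (MultilineQueue.fUp n j M) j = (row M j).erase (x + 1) := by
    rw [fUp_eq hx, if_neg hx0, row_mv_source (by omega)]
  refine ⟨⟨by rw [hr]; exact h4, fun y => ?_, x + 1, hx.1, ?_⟩, ?_⟩
  · rw [hr, pre_erase h1, fUp_eq hx, if_neg hx0, pre_row_mv hm.1 hm.2, h.above]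
    simp only [true_and]
    split_ifs <;> omega
  · rw [hr, pre_erase h1, if_pos le_rfl, h3]
    ring
  · rw [hr, Finset.card_erase_add_one h1]

theorem Raised.iterate (h : Raised n j S B u M) (hS : S ⊆ Finset.Icc 1 n)
    (hB : B ⊆ Finset.Icc 1 n) (m : ℕ) (hm : m ≤ u) :
    Raised n j S B (u - m) ((MultilineQueue.fUp n j)^[m] M) ∧
      (row ((MultilineQueue.fUp n j)^[m] M) j).card + m = (row M j).card := by
  induction m with
  | zero => simpa using h
  | succ m ih =>
    push_cast at hm
    obtain ⟨h1, h2⟩ := ih (by omega)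
    rw [Function.iterate_succ_apply']
    obtain ⟨h3, h4⟩ := h1.fUp hS hB (by omega)
    refine ⟨?_, by omega⟩
    push_cast
    rwa [← sub_sub]

theorem pre_eq_of_le {A : Finset ℕ} {x : ℕ} (h : A ⊆ Finset.Icc 1 n) (hx : n ≤ x) :
    pre A x = pre A n := by
  rw [pre_of_le h hx, pre_of_le h le_rfl]

/-- The starting point: with as many virtual balls as the maximal balance, every ball of row `j` is
paired. -/
theorem raised_self (hM : M ⊆ box L n) {x : ℕ} (hx : x ≤ n)
    (h : ∀ y ≤ n, rowBal M j y ≤ rowBal M j x) :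
    Raised n j (row M (j + 1)) (row M j) (rowBal M j x) M := by
  refine ⟨⟨subset_rfl, fun y => ?_, fun b hb hb' => absurd hb hb'⟩, fun y => by ring, x, hx, ?_⟩
  · rcases le_total y n with hy | hy
    · have := h y hy
      unfold rowBal at this ⊢
      omega
    · rw [pre_eq_of_le (row_subset hM j) hy, pre_eq_of_le (row_subset hM (j + 1)) hy]
      have := h n le_rfl
      unfold rowBal at this ⊢
      omega
  · unfold rowBal; ring

/-- Exchanging the sizes of the rows `j` and `j + 1` pairs the balls cyclically. -/
theorem pairing_fUp_iterate (hM : M ⊆ box L n) {a : ℕ}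
    (ha : rowCard M j = rowCard M (j + 1) + a) :
    ∃ u, Pairing (row M (j + 1)) (row M j) (row ((fUp n j)^[a] M) j) u ∧
      (row ((fUp n j)^[a] M) j).card = (row M (j + 1)).card := by
  obtain ⟨x, hx⟩ := exists_firstMax (rowBal M j) n
  have h := raised_self hM hx.1 fun y hy => (hx.2 y hy).1
  have h1 := (hx.2 n le_rfl).1
  rw [rowBal_of_le hM le_rfl] at h1
  -- The number `a` is the balance at `n`, hence at most the maximum, which is the number of virtual
  -- balls available.
  obtain ⟨h2, h3⟩ := h.iterate (row_subset hM _) (row_subset hM _) a (by omega)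
  rw [card_row M j] at h3
  rw [card_row M (j + 1)]
  exact ⟨_, h2.pairing, by omega⟩

/-- Here `m` counts the effective drops. Undoing them by raising makes the description by `Raised`
available for `M`, seen from its dropped image. -/
theorem eDown_iterate_spec (hM : M ⊆ box L n) (hj1 : 1 ≤ j) (hj : j < L) (k : ℕ) :
    ∃ m, (fUp n j)^[m] ((eDown L n j)^[k] M) = M ∧
      rowCard ((eDown L n j)^[k] M) (j + 1) + m = rowCard M (j + 1) ∧
      (∃ y ≤ n, m ≤ rowBal ((eDown L n j)^[k] M) j y) ∧
      (LowHw n ((eDown L n j)^[k] M) j ∨ m = k) := by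
  induction k with
  | zero => exact ⟨0, rfl, rfl, ⟨0, by omega, by simp [rowBal_zero hM]⟩, Or.inr rfl⟩
  | succ k ih =>
    obtain ⟨m, h1, h2, ⟨y, hy, h3⟩, h4⟩ := ih
    rw [Function.iterate_succ_apply']
    generalize (eDown L n j)^[k] M = F at h1 h2 h3 h4 ⊢
    obtain ⟨x, hx⟩ := exists_lastMax (rowBal F j) n
    by_cases hlow : LowHw n F j
    · have : eDown L n j F = F := by
        rw [eDown_eq hj1 hj hx, if_neg]
        rw [lowHw_iff_eq hx] at hlow
        omega
      rw [this]
      exact ⟨m, h1, h2, ⟨y, hy, h3⟩, Or.inl hlow⟩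
    · have hxn : x < n := by
        rw [lowHw_iff_eq hx] at hlow
        exact lt_of_le_of_ne hx.1 hlow
      have hmem := hx.mem_row hxn
      refine ⟨m + 1, ?_, ?_, ⟨x + 1, hxn, ?_⟩, ?_⟩
      · rw [Function.iterate_succ_apply, fUp_eDown hj1 hj hx hxn, h1]
      · rw [eDown_eq hj1 hj hx, if_pos hxn]
        have := rowCard_mv hmem.1 hmem.2 (j + 1)
        simp at this
        omega
      · rw [eDown_eq hj1 hj hx, if_pos hxn, rowBal_mv_vert hmem.1 hmem.2, rowBal_succ,
          if_neg hmem.2, if_pos hmem.1]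
        have := (hx.2 y hy).1
        push_cast
        simp
        omega
      · right
        rw [h4.resolve_left hlow]

/-- The number of elements of `A` in `(x, n]`, for `A ⊆ [1, n]`. -/
def suf (n : ℕ) (A : Finset ℕ) (x : ℕ) : ℤ := pre A n - pre A x

theorem suf_anti {n : ℕ} (A : Finset ℕ) {x y : ℕ} (h : x ≤ y) : suf n A y ≤ suf n A x := by
  unfold suf
  have := pre_mono A h
  omega

theorem suf_nonneg {n : ℕ} (A : Finset ℕ) {x : ℕ} (h : x ≤ n) : 0 ≤ suf n A x := by
  unfold suf
  have := pre_mono A h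
  omega

theorem suf_zero {A : Finset ℕ} (h : A ⊆ Finset.Icc 1 n) : suf n A 0 = A.card := by
  unfold suf
  rw [pre_zero (zero_notMem_of_subset h), pre_of_le h le_rfl, sub_zero]

theorem lowHw_iff_suf : LowHw n M j ↔ ∀ x ≤ n, suf n (row M (j + 1)) x ≤ suf n (row M j) x := by
  refine forall_congr' fun x => forall_congr' fun _ => ?_
  unfold rowBal suf
  constructor <;> intro <;> omega

/-- Dropping all unmatched balls turns the rows `U` above `V` to `U'` above `V'`; there are `σ x`
dropped balls to the right of `x`. -/
structure Drop (n : ℕ) (U V U' V' : Finset ℕ) (σ : ℕ → ℤ) : Prop where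
  low : ∀ x, suf n V' x = suf n V x + σ x
  high : ∀ x, suf n U' x = suf n U x - σ x
  le : ∀ x, suf n U' x ≤ suf n V x
  nonneg : ∀ x ≤ n, 0 ≤ σ x
  anti : ∀ x y, x ≤ y → σ y ≤ σ x
  attained : ∀ x ≤ n, σ x = 0 ∨ ∃ y, x ≤ y ∧ y ≤ n ∧ σ x = suf n U y - suf n V y

/-- After all drops the maximal balance is at `n`; raising `m` balls back from there shows that the
old row `j` is a pairing inside the new row `j`. The counts in `Drop` are read off from this. -/
theorem eDownStar_spec (hM : M ⊆ box L n) (hj1 : 1 ≤ j) (hj : j < L) :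
    (∃ t : ℤ, 0 ≤ t ∧ (rowCard M j : ℤ) = rowCard (eDownStar L n j M) (j + 1) + t ∧
      Pairing (row (eDownStar L n j M) (j + 1)) (row (eDownStar L n j M) j) (row M j) t) ∧
    ∃ σ, Drop n (row M (j + 1)) (row M j) (row (eDownStar L n j M) (j + 1))
      (row (eDownStar L n j M) j) σ := by
  obtain ⟨m, h1, h2, ⟨y, hy, h3⟩, h4⟩ := eDown_iterate_spec hM hj1 hj M.card
  have hF := (IsVertical.eDownStar (n := n) hj1 hj).subset hM
  unfold eDownStar at hF ⊢
  generalize (eDown L n j)^[M.card] M = F at h1 h2 h3 h4 hF ⊢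
  have hlow : LowHw n F j := by
    rcases h4 with h | rfl
    · exact h
    -- If all `M.card` applications were effective, row `j + 1` has been emptied.
    · have : rowCard M (j + 1) ≤ M.card := Finset.card_filter_le _ _
      have h0 : rowCard F (j + 1) = 0 := by omega
      rw [← card_row, Finset.card_eq_zero] at h0
      intro x hx
      unfold rowBal
      have := pre_mono (row F j) hx
      simp only [h0, show ∀ x, pre ∅ x = 0 from fun x => by simp [pre]]
      omega
  have hr := raised_self hF le_rfl hlow
  have hmn : (m : ℤ) ≤ rowBal F j n := h3.trans (hlow y hy)
  obtain ⟨h5, h6⟩ := hr.iterate (row_subset hF _) (row_subset hF _) m hmn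
  rw [h1] at h5 h6
  rw [card_row, card_row] at h6
  have hbn := rowBal_of_le hF le_rfl j
  generalize htdef : rowBal F j n - m = t at h5
  have hp := h5.pairing
  have hcard : (rowCard M j : ℤ) = rowCard F (j + 1) + t := by omega
  refine ⟨⟨t, by omega, hcard, hp⟩, ?_⟩
  have e1 : pre (row M j) n = pre (row F (j + 1)) n + t := by
    rw [pre_of_le (row_subset hM _) le_rfl, pre_of_le (row_subset hF _) le_rfl, card_row, card_row]
    exact hcard
  refine ⟨fun x => suf n (row F j) x - suf n (row M j) x, ⟨fun x => by ring, fun x => ?_,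
    fun x => ?_, fun x hx => ?_, fun x z hxz => ?_, fun x hx => ?_⟩⟩
  · unfold suf
    rw [h5.above, h5.above]
    ring
  · have := hp.le x
    unfold suf
    omega
  · unfold suf
    have := pre_sub_le hp.sub hx
    omega
  · simp only [suf]
    have := pre_sub_le hp.sub hxz
    omega
  · by_cases hex : ∃ b, x < b ∧ b ≤ n ∧ b ∈ row F j ∧ b ∉ row M j
    · right
      -- The first dropped ball to the right of `x`; the maximum of the excess of the upper row is
      -- attained just before it.
      obtain ⟨b, ⟨hb1, hb2, hb3, hb4⟩, hmin⟩ : ∃ b, (x < b ∧ b ≤ n ∧ b ∈ row F j ∧ b ∉ row M j) ∧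
          ∀ c < b, ¬(x < c ∧ c ≤ n ∧ c ∈ row F j ∧ c ∉ row M j) :=
        by classical exact ⟨Nat.find hex, Nat.find_spec hex, fun c hc => Nat.find_min hex hc⟩
      obtain ⟨c, rfl⟩ : ∃ c, b = c + 1 := ⟨b - 1, by omega⟩
      refine ⟨c, by omega, by omega, ?_⟩
      have f1 := hp.free _ hb3 hb4
      have f2 := hp.le c
      have f3 := pre_succ (row M j) c
      rw [if_neg hb4] at f3
      have f4 := pre_mono (row F (j + 1)) (show c ≤ c + 1 by omega)
      have f5 := pre_sub_eq (K := row M j) (A := row F j) (show x ≤ c by omega) fun a g1 g2 =>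
        ⟨fun h => hp.sub h, fun h => by
          by_contra hk
          exact hmin a (by omega) ⟨g1, by omega, h, hk⟩⟩
      have f6 := h5.above c
      have f7 := h5.above n
      unfold suf
      omega
    · left
      push Not at hex
      have := pre_sub_eq (K := row M j) (A := row F j) hx fun a g1 g2 =>
        ⟨fun h => hp.sub h, fun h => hex a g1 g2 h⟩
      unfold suf
      omega

theorem Drop.lowHw {σ : ℕ → ℤ} (M : Config)
    (h : Drop n (row M (j + 1)) (row M j) (row (eDownStar L n j M) (j + 1))
      (row (eDownStar L n j M) j) σ) : LowHw n (eDownStar L n j M) j := by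
  rw [lowHw_iff_suf]
  intro x hx
  have := h.le x
  have := h.low x
  have := h.nonneg x hx
  omega

theorem row_eDownStar_of_ne (hj1 : 1 ≤ j) (hj : j < L) (M : Config) {r : ℕ} (h1 : r ≠ j)
    (h2 : r ≠ j + 1) : row (eDownStar L n j M) r = row M r := by
  unfold eDownStar
  generalize M.card = k
  induction k with
  | zero => rfl
  | succ k ih => rw [Function.iterate_succ_apply', row_eDown_of_ne hj1 hj _ h1 h2, ih]

theorem lowHw_congr {M' : Config} (h1 : row M j = row M' j) (h2 : row M (j + 1) = row M' (j + 1)) :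
    LowHw n M j ↔ LowHw n M' j := by
  unfold LowHw rowBal
  rw [h1, h2]

end

/-! ### Collapsing gives configurations without droppable balls -/

theorem row_sweep_of_lt {L n i r : ℕ} (hi : i < L) (hr : i + 1 < r) (M : Config) :
    row (sweep L n i M) r = row M r := by
  induction i generalizing M with
  | zero => rfl
  | succ i ih =>
    unfold sweep
    rw [ih (by omega) (by omega), row_eDownStar_of_ne (by omega) hi _ (by omega) (by omega)]

/-- `R` is the suffix count of row `i + 1` before the preceding drop delivered balls to it. To the
right of any point, the next drop removes at most as many balls as were delivered, so row `i + 1`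
keeps at least `R` and still dominates the row above. The same bound shows that the rows below the
starting one do not shrink. -/
theorem sweep_spec {L n i m : ℕ} (him : i ≤ m) (hm : m < L) {W : Config} (hW : W ⊆ box L n)
    (R : ℕ → ℤ) (hR : 1 ≤ i → ∀ x ≤ n, R x ≤ suf n (row W i) x)
    (hanti : ∀ x y, x ≤ y → y ≤ n →
      suf n (row W (i + 1)) y - R y ≤ suf n (row W (i + 1)) x - R x)
    (hle : ∀ x ≤ n, R x ≤ suf n (row W (i + 1)) x)
    (hlow : ∀ j, 1 ≤ j → j < i → LowHw n W j)
    (hhigh : ∀ j, i < j → j ≤ m → LowHw n W j)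
    (hnext : i < m → ∀ x ≤ n, suf n (row W (i + 2)) x ≤ R x) :
    (∀ j, 1 ≤ j → j ≤ m → LowHw n (sweep L n i W) j) ∧
      R 0 ≤ suf n (row (sweep L n i W) (i + 1)) 0 ∧
      ∀ j, 1 ≤ j → j ≤ i → rowCard W j ≤ rowCard (sweep L n i W) j := by
  induction i generalizing W R with
  | zero => exact ⟨fun j hj1 hj => hhigh j (by omega) hj, hle 0 (by omega), fun j _ _ => by omega⟩
  | succ i ih =>
    obtain ⟨-, σ, hσ⟩ := eDownStar_spec hW (show 1 ≤ i + 1 by omega) (show i + 1 < L by omega)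
    have hlowst := hσ.lowHw (L := L)
    have hW' := (IsVertical.eDownStar (n := n) (show 1 ≤ i + 1 by omega)
      (show i + 1 < L by omega)).subset hW
    have hrow : ∀ r, r ≠ i + 1 → r ≠ i + 2 → row (eDownStar L n (i + 1) W) r = row W r :=
      fun r h1 h2 => row_eDownStar_of_ne (by omega) (by omega) W h1 h2
    have hkey : ∀ x ≤ n, R x ≤ suf n (row (eDownStar L n (i + 1) W) (i + 2)) x := by
      intro x hx
      have h1 := hσ.high x
      rw [h1]
      rcases hσ.attained x hx with h | ⟨y, hxy, hy, h⟩
      · have := hle x hx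
        omega
      · have h2 := hanti x y hxy hy
        have h3 := hR (by omega) y hy
        omega
    unfold sweep
    generalize eDownStar L n (i + 1) W = W' at *
    -- The next reference count is that of row `i + 1` before this drop; the excess over it is `σ`.
    obtain ⟨c1, c2, c3⟩ := ih (by omega) hW' (fun x => suf n (row W (i + 1)) x)
      (fun hi x hx => by
        rw [hrow i (by omega) (by omega)]
        exact lowHw_iff_suf.1 (hlow i hi (by omega)) x hx)
      (fun x y hxy hy => by
        have := hσ.low x
        have := hσ.low y
        have := hσ.anti x y hxy
        omega)
      (fun x hx => by
        have := hσ.low x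
        have := hσ.nonneg x hx
        omega)
      (fun j hj1 hj => (lowHw_congr (hrow j (by omega) (by omega))
        (hrow (j + 1) (by omega) (by omega))).2 (hlow j hj1 (by omega)))
      (fun j hj1 hj => by
        rcases Nat.lt_trichotomy j (i + 2) with h | rfl | h
        · obtain rfl : j = i + 1 := by omega
          exact hlowst
        · rw [lowHw_iff_suf]
          intro x hx
          rw [hrow (i + 2 + 1) (by omega) (by omega)]
          exact (hnext (by omega) x hx).trans (hkey x hx)
        · exact (lowHw_congr (hrow j (by omega) (by omega))
            (hrow (j + 1) (by omega) (by omega))).2 (hhigh j (by omega) hj))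
      (fun _ x _ => hσ.le x)
    refine ⟨c1, ?_, fun j hj1 hj => ?_⟩
    · rw [row_sweep_of_lt (by omega) (by omega)]
      exact hkey 0 (by omega)
    · rcases Nat.lt_or_ge i j with h | h
      · obtain rfl : j = i + 1 := by omega
        rw [suf_zero (row_subset hW _),
          suf_zero (row_subset ((IsVertical.sweep (by omega)).subset hW') _), card_row,
          card_row] at c2
        exact_mod_cast c2
      · have := c3 j hj1 h
        rwa [← card_row, hrow j (by omega) (by omega), card_row] at this

theorem sweep_stage {L n k : ℕ} {W : Config} (hk : k + 1 < L) (hW : W ⊆ box L n)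
    (h : ∀ j, 1 ≤ j → j ≤ k → LowHw n W j) :
    (∀ j, 1 ≤ j → j ≤ k + 1 → LowHw n (sweep L n (k + 1) W) j) ∧
      ∀ j, 1 ≤ j → j ≤ k + 1 → rowCard W j ≤ rowCard (sweep L n (k + 1) W) j := by
  -- With `R = 0` the whole topmost row involved counts as just delivered.
  obtain ⟨h1, -, h2⟩ := sweep_spec (le_refl (k + 1)) hk hW (fun _ => 0)
    (fun _ x hx => suf_nonneg _ hx) (fun x y hxy _ => by simpa using suf_anti _ hxy)
    (fun x hx => suf_nonneg _ hx) (fun j hj1 hj => h j hj1 (by omega))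
    (fun j hj1 hj => by omega) (fun h => by omega)
  exact ⟨h1, h2⟩

theorem lowHw_stage {L n k : ℕ} {M : Config} (hk : k = 0 ∨ k < L) (hM : M ⊆ box L n) :
    ∀ j, 1 ≤ j → j ≤ k → LowHw n (stage L n M k) j := by
  induction k with
  | zero => intro j h1 h2; omega
  | succ k ih =>
    exact (sweep_stage (by omega) ((IsVertical.stage (by omega)).subset hM) (ih (by omega))).1

theorem rowCard_stage_le {L n k j : ℕ} {M : Config} (hk : k + 1 < L) (hM : M ⊆ box L n)
    (hj1 : 1 ≤ j) (hj : j ≤ k + 1) :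
    rowCard (stage L n M k) j ≤ rowCard (stage L n M (k + 1)) j :=
  (sweep_stage hk ((IsVertical.stage (by omega)).subset hM) (lowHw_stage (by omega) hM)).2 j hj1 hj

theorem lowHw_collapse {L n j : ℕ} {M : Config} (hM : M ⊆ box L n) (hj1 : 1 ≤ j) (hj : j < L) :
    LowHw n (collapse L n M) j :=
  lowHw_stage (by omega) hM j hj1 (by omega)

/-- The starred dropping operators with index `1, 2, …, k`, where the one with index `1` is
applied first. -/
def upSweep (L n : ℕ) : ℕ → Config → Config
  | 0, M => M
  | k + 1, M => eDownStar L n (k + 1) (upSweep L n k M)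

theorem IsVertical.upSweep {L n k : ℕ} (hk : k = 0 ∨ k < L) : IsVertical L n (upSweep L n k) := by
  induction k with
  | zero => exact IsVertical.id
  | succ k ih => exact (IsVertical.eDownStar (by omega) (by omega)).comp (ih (by omega))

theorem row_upSweep_of_lt {L n k r : ℕ} (hk : k = 0 ∨ k < L) (hr : k + 1 < r) (M : Config) :
    row (upSweep L n k M) r = row M r := by
  induction k with
  | zero => rfl
  | succ k ih =>
    unfold upSweep
    rw [row_eDownStar_of_ne (by omega) (by omega) _ (by omega) (by omega),
      ih (by omega) (by omega)]

theorem row_upSweep_of_le {L n k m r : ℕ} (hkm : k ≤ m) (hm : m < L) (hr : r ≤ k)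
    (M : Config) : row (upSweep L n m M) r = row (upSweep L n k M) r := by
  induction m, hkm using Nat.le_induction with
  | base => rfl
  | succ m _ ih =>
    rw [upSweep, row_eDownStar_of_ne (by omega) (by omega) _ (by omega) (by omega), ih (by omega)]

/-- A drop into row `k` leaves a slack `σ` between rows `k + 1` and `k`. As row `k + 2` was
dominated by the old row `k + 1`, the next drop delivers at most `σ` balls to the right of any
point, so it does not spoil the order below. -/
theorem upSweep_spec {L n k : ℕ} {Y : Config} (hk : k = 0 ∨ k < L) (hY : Y ⊆ box L n)
    (h : ∀ j, 2 ≤ j → j < L → LowHw n Y j) :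
    (∀ j, 1 ≤ j → j < k → LowHw n (upSweep L n k Y) j) ∧ ∃ σ : ℕ → ℤ,
      (∀ x, suf n (row (upSweep L n k Y) (k + 1)) x + σ x = suf n (row Y (k + 1)) x) ∧
      (1 ≤ k → ∀ x, suf n (row (upSweep L n k Y) (k + 1)) x + σ x ≤
        suf n (row (upSweep L n k Y) k) x) ∧
      (∀ x ≤ n, 0 ≤ σ x) ∧ ∀ x y, x ≤ y → σ y ≤ σ x := by
  induction k with
  | zero =>
    exact ⟨fun j _ _ => by omega, fun _ => 0, fun x => by simp [upSweep], fun _ => by omega,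
      fun _ _ => le_rfl, fun _ _ _ => le_rfl⟩
  | succ k ih =>
    obtain ⟨h1, σ, i1, i2, i3, i4⟩ := ih (by omega)
    have hZ := (IsVertical.upSweep (L := L) (n := n) (k := k) (by omega)).subset hY
    have hrow0 := row_upSweep_of_lt (L := L) (n := n) (k := k) (r := k + 2) (by omega)
      (by omega) Y
    rw [upSweep]
    generalize upSweep L n k Y = Z at *
    obtain ⟨-, τ, hτ⟩ := eDownStar_spec hZ (show 1 ≤ k + 1 by omega) (show k + 1 < L by omega)
    have hrow : ∀ r, r ≠ k + 1 → r ≠ k + 2 → row (eDownStar L n (k + 1) Z) r = row Z r :=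
      fun r h1 h2 => row_eDownStar_of_ne (by omega) (by omega) Z h1 h2
    generalize eDownStar L n (k + 1) Z = Z' at *
    have hle : 1 ≤ k → ∀ x ≤ n, τ x ≤ σ x := by
      intro hk1 x hx
      rcases hτ.attained x hx with e | ⟨y, hxy, hy, e⟩
      · rw [e]; exact i3 x hx
      · have e1 := lowHw_iff_suf.1 (h (k + 1) (by omega) (by omega)) y hy
        have e2 := i1 y
        have e3 := i4 x y hxy
        rw [show k + 1 + 1 = k + 2 by rfl] at e e1
        rw [hrow0] at e
        omega
    refine ⟨fun j hj1 hj => ?_, τ, fun x => ?_, fun _ x => ?_, hτ.nonneg, hτ.anti⟩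
    · rcases Nat.lt_or_ge j k with h2 | h2
      · exact (lowHw_congr (hrow j (by omega) (by omega))
          (hrow (j + 1) (by omega) (by omega))).2 (h1 j hj1 h2)
      · obtain rfl : j = k := by omega
        rw [lowHw_iff_suf]
        intro x hx
        rw [hrow j (by omega) (by omega), hτ.low]
        have := hle hj1 x hx
        have := i2 hj1 x
        omega
    · rw [hτ.high, show k + 1 + 1 = k + 2 by rfl, hrow0]
      ring
    · have := hτ.le x
      have := hτ.low x
      omega

theorem lowHw_upSweep {L n j : ℕ} {Y : Config} (hY : Y ⊆ box L n)
    (h : ∀ j, 2 ≤ j → j < L → LowHw n Y j) (hj1 : 1 ≤ j) (hj : j < L) :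
    LowHw n (upSweep L n (L - 1) Y) j := by
  obtain ⟨h1, σ, i1, i2, i3, i4⟩ := upSweep_spec (k := L - 1) (by omega) hY h
  rcases Nat.lt_or_ge j (L - 1) with h2 | h2
  · exact h1 j hj1 h2
  · obtain rfl : j = L - 1 := by omega
    rw [lowHw_iff_suf]
    intro x hx
    have := i2 hj1 x
    have := i3 x hx
    omega

/-- Some composition of dropping operators with index at least `2` leaves no droppable balls in
the rows above row `2`. -/
theorem exists_lowHw_above {L n : ℕ} {M : Config} (hM : M ⊆ box L n) :
    ∃ Φ : Config → Config, IsVertical L n Φ ∧ (∀ A, row (Φ A) 1 = row A 1) ∧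
      ∀ j, 2 ≤ j → j < L → LowHw n (Φ M) j := by
  induction hw : ∑ u ∈ M, u.1 using Nat.strong_induction_on generalizing M with
  | _ w ih =>
    by_cases h : ∀ j, 2 ≤ j → j < L → LowHw n M j
    · exact ⟨fun M => M, IsVertical.id, fun _ => rfl, h⟩
    · push Not at h
      obtain ⟨j, hj2, hj, hlow⟩ := h
      obtain ⟨x, hx⟩ := exists_lastMax (rowBal M j) n
      have hxn : x < n := by
        rw [lowHw_iff_eq hx] at hlow
        exact lt_of_le_of_ne hx.1 hlow
      have hv : IsVertical L n (eDown L n j) := IsVertical.eDown (by omega) hj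
      have hsum := sum_mv (hx.mem_row hxn).1 (hx.mem_row hxn).2 Prod.fst
      have he := eDown_eq (L := L) (by omega) hj hx
      rw [if_pos hxn] at he
      obtain ⟨Φ, h1, h2, h3⟩ := ih (∑ u ∈ eDown L n j M, u.1) (by rw [he]; simp only at hsum; omega)
        (hv.subset hM) rfl
      -- The composition is chosen for `M` but applies to all configurations, so it can be used on
      -- the other elements of the component. The sum of the row numbers ensures termination.
      exact ⟨fun A => Φ (eDown L n j A), h1.comp hv, fun A => by
        rw [h2, row_eDown_of_ne (by omega) hj A (by omega) (by omega)], h3⟩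

/-! ### Configurations of highest weight for both kinds of operators -/

/-- Induction on rows. As row `r + 1` is an initial interval, domination of suffix counts puts a
ball below every ball of row `r + 2`. The columns `c` and `c + 1` are then equally full up to row `r
+ 1`, so the column condition at row `r + 2` forces a ball to the left. -/
theorem mem_of_colHw {L n m : ℕ} {M : Config} (hM : M ⊆ box L n) (hm : m ≤ L) (h : ColHw L n M)
    (hl : ∀ j, 1 ≤ j → j < m → LowHw n M j) :
    ∀ r, r + 1 ≤ m → (∀ c, 1 ≤ c → (r + 1, c + 1) ∈ M → (r + 1, c) ∈ M) ∧
      ∀ c, (r + 1, c) ∈ M → ∀ s, 1 ≤ s → s ≤ r + 1 → (s, c) ∈ M := by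
  have full : ∀ r c, (∀ s, 1 ≤ s → s ≤ r → (s, c) ∈ M) → pre (col M c) r = r := by
    intro r c hs
    have := pre_eq_of (K := col M c) (A := Finset.Icc 1 r) (x := r) fun a ha => by
      simp only [mem_col, Finset.mem_Icc]
      refine ⟨fun h' => ?_, fun h' => hs a h'.1 h'.2⟩
      have := hM h'
      simp only [Finset.mem_product, Finset.mem_Icc] at this
      omega
    rw [this, pre_of_le subset_rfl le_rfl]
    simp
  intro r
  induction r with
  | zero =>
    intro hr
    refine ⟨fun c hc hcM => ?_, fun c hc s hs1 hs => by rwa [show s = 0 + 1 by omega]⟩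
    have hcn := hM hcM
    simp only [Finset.mem_product, Finset.mem_Icc] at hcn
    have h1 := h c hc (by omega) 1 (by omega)
    have h2 := colBal_succ M c 0
    rw [colBal_zero hM, if_pos hcM] at h2
    by_contra hcon
    rw [if_neg hcon] at h2
    simp at h2
    omega
  | succ r ih =>
    intro hr
    obtain ⟨d, g⟩ := ih (by omega)
    have hdown : ∀ k c, 1 ≤ c → (r + 1, c + k) ∈ M → (r + 1, c) ∈ M := by
      intro k
      induction k with
      | zero => intro c _ h; exact h
      | succ k ihk => intro c hc h'; exact ihk c hc (d (c + k) (by omega) h')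
    have hbelow : ∀ c, (r + 1 + 1, c) ∈ M → (r + 1, c) ∈ M := by
      intro c hc
      have hcn := hM hc
      simp only [Finset.mem_product, Finset.mem_Icc] at hcn
      have h1 := lowHw_iff_suf.1 (hl (r + 1) (by omega) (by omega)) (c - 1) (by omega)
      have h2 : 1 ≤ suf n (row M (r + 1 + 1)) (c - 1) := by
        have := pre_pred (mem_row.2 hc) (show c - 1 < c by omega)
        have := pre_mono (row M (r + 1 + 1)) hcn.2.2
        unfold suf
        omega
      by_contra hcon
      have h3 : suf n (row M (r + 1)) (c - 1) = 0 := by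
        have := pre_sub_eq (K := row M (r + 1)) (A := ∅) (show c - 1 ≤ n by omega)
          fun a g1 g2 => by
            simp only [mem_row, Finset.notMem_empty, iff_false]
            intro h'
            obtain ⟨k, rfl⟩ : ∃ k, a = c + k := ⟨a - c, by omega⟩
            exact hcon (hdown k c (by omega) h')
        unfold suf
        rw [this]
        simp [pre]
      omega
    refine ⟨fun c hc hcM => ?_, fun c hc s hs1 hs => ?_⟩
    · have hcn := hM hcM
      simp only [Finset.mem_product, Finset.mem_Icc] at hcn
      have h1 := hbelow _ hcM
      have h2 := d c hc h1
      have f1 := full (r + 1) c fun s a b => g c h2 s a b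
      have f2 := full (r + 1) (c + 1) fun s a b => g (c + 1) h1 s a b
      have h3 := h c hc (by omega) (r + 1 + 1) (by omega)
      rw [colBal_succ, if_pos hcM] at h3
      by_contra hcon
      rw [if_neg hcon] at h3
      unfold colBal at h3
      omega
    · rcases Nat.lt_or_ge (r + 1) s with h' | h'
      · rwa [show s = r + 1 + 1 by omega]
      · exact g c (hbelow c hc) s hs1 h'

theorem eq_Icc_of_downClosed {A : Finset ℕ} (h0 : 0 ∉ A) (h : ∀ c, 1 ≤ c → c + 1 ∈ A → c ∈ A) :
    A = Finset.Icc 1 A.card := by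
  have hdown : ∀ k c, 1 ≤ c → c + k ∈ A → c ∈ A := by
    intro k
    induction k with
    | zero => intro c _ h; exact h
    | succ k ihk => intro c hc h'; exact ihk c hc (h (c + k) (by omega) h')
  have hsub : ∀ a ∈ A, Finset.Icc 1 a ⊆ A := by
    intro a ha c hc
    simp only [Finset.mem_Icc] at hc
    obtain ⟨k, rfl⟩ : ∃ k, a = c + k := ⟨a - c, by omega⟩
    exact hdown k c hc.1 ha
  refine Finset.eq_of_subset_of_card_le (fun a ha => ?_) (by simp)
  have h1 := Finset.card_le_card (hsub a ha)
  simp only [Nat.card_Icc, add_tsub_cancel_right] at h1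
  have : a ≠ 0 := fun e => h0 (e ▸ ha)
  simp only [Finset.mem_Icc]
  omega

theorem row_eq_Icc {L n m r : ℕ} {M : Config} (hM : M ⊆ box L n) (hm : m ≤ L) (h : ColHw L n M)
    (hl : ∀ j, 1 ≤ j → j < m → LowHw n M j) (hr1 : 1 ≤ r) (hr : r ≤ m) :
    row M r = Finset.Icc 1 (rowCard M r) := by
  obtain ⟨r, rfl⟩ : ∃ k, r = k + 1 := ⟨r - 1, by omega⟩
  rw [← card_row]
  refine eq_Icc_of_downClosed (zero_notMem_of_subset (row_subset hM _)) fun c hc hcM => ?_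
  exact mem_row.2 ((mem_of_colHw hM hm h hl r hr).1 c hc (mem_row.1 hcM))

/-- A configuration of highest weight for both kinds of operators is determined by its column
counts. -/
theorem eq_of_highest {L n : ℕ} {M M' : Config} (hM : M ⊆ box L n) (hM' : M' ⊆ box L n)
    (h : ColHw L n M) (h' : ColHw L n M') (hl : ∀ j, 1 ≤ j → j < L → LowHw n M j)
    (hl' : ∀ j, 1 ≤ j → j < L → LowHw n M' j)
    (hc : ∀ c, pre (col M c) L = pre (col M' c) L) : M = M' := by
  have key : ∀ {M : Config}, M ⊆ box L n → ColHw L n M → (∀ j, 1 ≤ j → j < L → LowHw n M j) →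
      ∀ c, col M c = Finset.Icc 1 (col M c).card := by
    intro M hM h hl c
    refine eq_Icc_of_downClosed (zero_notMem_of_subset (col_subset hM _)) fun r hr hrM => ?_
    rw [mem_col] at hrM ⊢
    have hrn := hM hrM
    simp only [Finset.mem_product, Finset.mem_Icc] at hrn
    exact (mem_of_colHw hM le_rfl h hl r hrn.1.2).2 c hrM r hr (by omega)
  ext ⟨r, c⟩
  rw [← mem_col, ← mem_col, key hM h hl c, key hM' h' hl' c]
  have := hc c
  rw [pre_of_le (col_subset hM _) le_rfl, pre_of_le (col_subset hM' _) le_rfl] at this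
  rw [show (col M c).card = (col M' c).card by exact_mod_cast this]

/-! ### The type as an iterated queue -/

/-- The columns in `[1, n]` whose label is at least `k`. -/
def labSet (n : ℕ) (f : ℕ → ℕ) (k : ℕ) : Finset ℕ := (Finset.Icc 1 n).filter fun c => k ≤ f c

theorem mem_labSet {n k c : ℕ} {f : ℕ → ℕ} : c ∈ labSet n f k ↔ (1 ≤ c ∧ c ≤ n) ∧ k ≤ f c := by
  simp [labSet]

theorem labSet_anti (n : ℕ) (f : ℕ → ℕ) {k l : ℕ} (h : k ≤ l) : labSet n f l ⊆ labSet n f k := by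
  intro c
  simp only [mem_labSet]
  exact fun h' => ⟨h'.1, h.trans h'.2⟩

/-- The balls `K` of `B` are paired cyclically with the balls of `P`. -/
def CycPairing (P B K : Finset ℕ) : Prop := (∃ u, Pairing P B K u) ∧ K.card = P.card

theorem CycPairing.unique {P B K K' : Finset ℕ} (h : CycPairing P B K) (h' : CycPairing P B K') :
    K = K' := by
  obtain ⟨⟨u, hu⟩, e⟩ := h
  obtain ⟨⟨u', hu'⟩, e'⟩ := h'
  exact hu.unique_of_card hu' (e.trans e'.symm)

theorem find?_cyclicFrom {n c : ℕ} (p : ℕ → Bool) {b : ℕ} (hb1 : 1 ≤ b) (hbn : b ≤ n) (hb : p b) :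
    ∃ d, (cyclicFrom n c).find? p = some d ∧ p d ∧
      ((c ≤ d ∧ ∀ a, a ≤ n → p a → c ≤ a → d ≤ a) ∨
        ∀ a, 1 ≤ a → a ≤ n → p a → a < c ∧ d ≤ a) := by
  unfold cyclicFrom
  rw [List.find?_append]
  rcases h1 : List.find? p (List.range' c (n + 1 - c)) with _ | d
  · rw [List.find?_range'_eq_none] at h1
    have h1' : ∀ i, i ≤ n → p i → i < c := by
      intro i hin hp
      by_contra hc
      have := h1 i (by omega) (by omega)
      simp [hp] at this
    rcases h2 : List.find? p (List.range' 1 (c - 1)) with _ | d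
    · rw [List.find?_range'_eq_none] at h2
      have := h2 b hb1 (by have := h1' b hbn hb; omega)
      simp [hb] at this
    · rw [List.find?_range'_eq_some] at h2
      obtain ⟨g1, g2, g3⟩ := h2
      refine ⟨d, rfl, g1, Or.inr fun a ha1 han hp => ⟨h1' a han hp, ?_⟩⟩
      by_contra hc
      have := g3 a ha1 (by omega)
      simp [hp] at this
  · rw [List.find?_range'_eq_some] at h1
    obtain ⟨g1, g2, g3⟩ := h1
    rw [List.mem_range'_1] at g2
    refine ⟨d, rfl, g1, Or.inl ⟨g2.1, fun a han hp hca => ?_⟩⟩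
    by_contra hc
    have := g3 a hca (by omega)
    simp [hp] at this

section

variable {L n r : ℕ} {M : Config}

/-- A pairing without wrapping keeps the number of virtual balls, and one with wrapping adds one.
The size condition ensures that a free ball is found. -/
theorem pairOne_spec (hM : M ⊆ box L n) {c a : ℕ} {cur : ℕ → ℕ} {P : Finset ℕ} (ha : 1 ≤ a)
    (hcP : c ∉ P) (h : CycPairing P (row M r) (labSet n cur 1))
    (hcard : P.card < (row M r).card) :
    CycPairing (insert c P) (row M r) (labSet n (pairOne n M r c a cur) 1) ∧
      ∀ d, pairOne n M r c a cur d = cur d ∨ (cur d = 0 ∧ pairOne n M r c a cur d = a) := by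
  obtain ⟨⟨u, hu⟩, hc⟩ := h
  have free_iff : ∀ d, ((r, d) ∈ M ∧ cur d = 0) ↔ d ∈ row M r ∧ d ∉ labSet n cur 1 := by
    intro d
    simp only [mem_row, mem_labSet, not_and, not_le, Nat.lt_one_iff]
    refine and_congr_right fun h => ⟨fun h' _ => h', fun h' => h' ?_⟩
    have := hM h
    simp only [Finset.mem_product, Finset.mem_Icc] at this
    exact this.2
  have main : ∀ d, (r, d) ∈ M → cur d = 0 →
      (∃ u', Pairing (insert c P) (row M r) (insert d (labSet n cur 1)) u') →
      pairOne n M r c a cur = Function.update cur d a →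
      CycPairing (insert c P) (row M r) (labSet n (pairOne n M r c a cur) 1) ∧
      ∀ d, pairOne n M r c a cur d = cur d ∨ (cur d = 0 ∧ pairOne n M r c a cur d = a) := by
    intro d hd hd0 hpair he
    have hset : labSet n (Function.update cur d a) 1 = insert d (labSet n cur 1) := by
      have hdn := hM hd
      simp only [Finset.mem_product, Finset.mem_Icc] at hdn
      ext b
      simp only [Finset.mem_insert, mem_labSet]
      by_cases hb : b = d
      · subst hb
        simp [ha, hdn.2]
      · simp [hb]
    rw [he]
    refine ⟨⟨by rw [hset]; exact hpair, ?_⟩, fun b => ?_⟩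
    · rw [hset, Finset.card_insert_of_notMem ((free_iff d).1 ⟨hd, hd0⟩).2,
        Finset.card_insert_of_notMem hcP, hc]
    · by_cases hb : b = d
      · subst hb
        simp [hd0]
      · simp [hb]
  have hbox : ∀ d, (r, d) ∈ M → 1 ≤ d ∧ d ≤ n := by
    intro d hd
    have := hM hd
    simp only [Finset.mem_product, Finset.mem_Icc] at this
    exact this.2
  obtain ⟨b, hb, hb'⟩ := Finset.exists_mem_notMem_of_card_lt_card (hc ▸ hcard)
  obtain ⟨d, hd, hpd, hor⟩ := find?_cyclicFrom (n := n) (c := c)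
    (fun d => decide ((r, d) ∈ M ∧ cur d = 0)) (hbox b (mem_row.1 hb)).1 (hbox b (mem_row.1 hb)).2
    (by simpa using (free_iff b).2 ⟨hb, hb'⟩)
  simp only [decide_eq_true_eq] at hpd hor
  obtain ⟨hd1, hd2⟩ := (free_iff d).1 hpd
  refine main d hpd.1 hpd.2 ?_ (by unfold pairOne; rw [hd])
  rcases hor with ⟨hcd, hno⟩ | hno
  · exact ⟨u, hu.insert_right hcP hd1 hd2 hcd fun a ha ha' hca =>
      hno a (hbox a (mem_row.1 ha)).2 ((free_iff a).2 ⟨ha, ha'⟩) hca⟩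
  · exact ⟨u + 1, hu.insert_wrap hcP hd1 hd2 fun a ha ha' =>
      hno a (hbox a (mem_row.1 ha)).1 (hbox a (mem_row.1 ha)).2 ((free_iff a).2 ⟨ha, ha'⟩)⟩

theorem foldl_pairOne_spec (hM : M ⊆ box L n) {lab : ℕ → ℕ} {a : ℕ} (ha : 1 ≤ a) (cs : List ℕ)
    {cur : ℕ → ℕ} {P : Finset ℕ} (hcs : cs.Nodup) (hP : ∀ c ∈ cs, c ∉ P) (hlab : ∀ c ∈ cs, lab c = a)
    (h : CycPairing P (row M r) (labSet n cur 1))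
    (hcard : P.card + cs.length ≤ (row M r).card) :
    CycPairing (P ∪ cs.toFinset) (row M r)
      (labSet n (cs.foldl (fun cur c => pairOne n M r c (lab c) cur) cur) 1) ∧
      ∀ d, cs.foldl (fun cur c => pairOne n M r c (lab c) cur) cur d = cur d ∨
        (cur d = 0 ∧ cs.foldl (fun cur c => pairOne n M r c (lab c) cur) cur d = a) := by
  induction cs generalizing cur P with
  | nil => simpa using h
  | cons c cs ih =>
    rw [List.nodup_cons] at hcs
    simp only [List.mem_cons, forall_eq_or_imp, List.length_cons] at hP hlab hcard
    obtain ⟨h1, h2⟩ := pairOne_spec (c := c) hM ha hP.1 h (by omega)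
    rw [List.foldl_cons, hlab.1]
    obtain ⟨h3, h4⟩ := ih (cur := pairOne n M r c a cur) (P := insert c P) hcs.2
      (fun b hb => by
        rw [Finset.mem_insert, not_or]
        exact ⟨fun e => hcs.1 (e ▸ hb), hP.2 b hb⟩) hlab.2 h1
      (by rw [Finset.card_insert_of_notMem hP.1]; omega)
    refine ⟨?_, fun d => ?_⟩
    · rw [List.toFinset_cons, Finset.union_insert, ← Finset.insert_union]
      exact h3
    · have g1 := h2 d
      have g2 := h4 d
      generalize pairOne n M r c a cur = f at *
      generalize List.foldl _ f cs d = e at *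
      omega

/-- For each `k`, the labels that are at least `k` are passed on by cyclic pairing. -/
theorem acquired_spec (hM : M ⊆ box L n) {lab : ℕ → ℕ} (hlab : ∀ c, lab c ≤ L)
    (hcard : (labSet n lab 1).card ≤ (row M r).card) {k : ℕ} (hk : 1 ≤ k) :
    CycPairing (labSet n lab k) (row M r) (labSet n (acquired L n M r lab) k) := by
  unfold acquired pairingOrder
  rw [List.foldl_flatMap]
  -- The invariant after treating the `m` largest labels `L, …, L + 1 - m`: later and smaller labels
  -- do not affect the sets at these thresholds.
  suffices H : ∀ m ≤ L, ∀ cur, ((List.range' (L + 1 - m) m).reverse.foldl (fun acc l =>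
      ((List.range' 1 n).filter fun c => lab c = l).foldl
        (fun cur c => pairOne n M r c (lab c) cur) acc) fun _ => 0) = cur →
      (∀ d, cur d ≠ 0 → L + 1 - m ≤ cur d) ∧
      ∀ k, L + 1 - m ≤ k → CycPairing (labSet n lab k) (row M r) (labSet n cur k) by
    exact (H L le_rfl _ (by rw [show L + 1 - L = 1 by omega])).2 k (by omega)
  intro m
  induction m with
  | zero =>
    rintro - cur rfl
    refine ⟨by simp, fun k hk => ?_⟩
    have e1 : labSet n lab k = ∅ := by
      ext c
      have := hlab c
      simp only [mem_labSet, Finset.notMem_empty, iff_false]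
      omega
    have e2 : labSet n (fun _ => 0) k = ∅ := by
      ext c
      simp only [mem_labSet, Finset.notMem_empty, iff_false]
      omega
    simp only [Nat.sub_zero, List.range'_zero, List.reverse_nil, List.foldl_nil]
    rw [e1, e2]
    exact ⟨⟨0, Finset.empty_subset _, by simp, by simp⟩, rfl⟩
  | succ m ih =>
    intro hm cur' hcur'
    obtain ⟨a, ha⟩ : ∃ a, L + 1 - (m + 1) = a := ⟨_, rfl⟩
    have ha' : L + 1 - m = a + 1 := by omega
    rw [ha] at hcur' ⊢
    rw [ha'] at ih
    rw [List.range'_succ, List.reverse_cons, List.foldl_append] at hcur'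
    obtain ⟨h1, h2⟩ := ih (by omega) _ rfl
    generalize List.foldl _ (fun _ : ℕ => (0 : ℕ)) (List.range' (a + 1) m).reverse = cur at h1 h2 hcur'
    simp only [List.foldl_cons, List.foldl_nil] at hcur'
    have hset : labSet n cur 1 = labSet n cur (a + 1) := by
      ext c
      have := h1 c
      simp only [mem_labSet]
      omega
    have hunion : labSet n lab (a + 1) ∪ ((List.range' 1 n).filter fun c => lab c = a).toFinset =
        labSet n lab a := by
      ext c
      simp only [Finset.mem_union, mem_labSet, List.mem_toFinset, List.mem_filter,
        List.mem_range'_1, decide_eq_true_eq]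
      omega
    have hnd : ((List.range' 1 n).filter fun c => lab c = a).Nodup :=
      List.Nodup.filter _ (List.nodup_range' ..)
    have hdisj : ∀ c ∈ (List.range' 1 n).filter fun c => lab c = a, c ∉ labSet n lab (a + 1) := by
      intro c hc
      simp only [List.mem_filter, decide_eq_true_eq] at hc
      simp only [mem_labSet]
      omega
    have hc : (labSet n lab (a + 1)).card +
        ((List.range' 1 n).filter fun c => lab c = a).length ≤ (row M r).card := by
      refine le_trans (le_of_eq ?_) ((Finset.card_le_card (labSet_anti n lab
        (show 1 ≤ a by omega))).trans hcard)
      rw [← hunion, Finset.card_union_of_disjoint, List.toFinset_card_of_nodup hnd]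
      rw [Finset.disjoint_right]
      intro c hc
      exact hdisj c (List.mem_toFinset.1 hc)
    obtain ⟨h3, h4⟩ := foldl_pairOne_spec (lab := lab) (a := a) hM (by omega) _ hnd hdisj
      (fun c hc => by simpa using (List.mem_filter.1 hc).2) (hset ▸ h2 (a + 1) le_rfl) hc
    rw [hcur', hunion] at h3
    rw [hcur'] at h4
    have hge : ∀ d, cur' d ≠ 0 → a ≤ cur' d := by
      intro d hd
      have := h1 d
      have := h4 d
      omega
    refine ⟨hge, fun k hk => ?_⟩
    rcases Nat.eq_or_lt_of_le hk with rfl | hk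
    · have : labSet n cur' a = labSet n cur' 1 := by
        ext c
        have := hge c
        simp only [mem_labSet]
        omega
      rw [this]
      exact h3
    · have : labSet n cur' k = labSet n cur k := by
        ext c
        have := h4 c
        simp only [mem_labSet]
        omega
      rw [this]
      exact h2 k hk

/-- The labels of row `r`. -/
def rowLabels (L n : ℕ) (M : Config) (r : ℕ) : ℕ → ℕ := labelsFromTop L n M (L + 1 - r)

theorem rowLabels_of_le (hr : r ≤ L) :
    rowLabels L n M r = labelRow L n M r (rowLabels L n M (r + 1)) := by
  unfold rowLabels
  rw [show L + 1 - r = (L - r) + 1 by omega, labelsFromTop, show L - (L - r) = r by omega,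
    show L + 1 - (r + 1) = L - r by omega]

/-- The new label `r` is smaller than all acquired ones, so thresholds above `r` do not see it.
Acquired labels are at least `r + 1` because cyclic pairing preserves the size of each level set. -/
theorem labelRow_spec (hM : M ⊆ box L n) {lab : ℕ → ℕ} (hr1 : 1 ≤ r) (hrL : r ≤ L)
    (hlab : ∀ c, lab c ≤ L) (hlow : ∀ c, lab c ≠ 0 → r + 1 ≤ lab c)
    (hcard : (labSet n lab 1).card ≤ (row M r).card) :
    (∀ c, labelRow L n M r lab c ≤ L) ∧
      (∀ c, labelRow L n M r lab c ≠ 0 → r ≤ labelRow L n M r lab c) ∧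
      labSet n (labelRow L n M r lab) 1 = row M r ∧
      ∀ k, r < k → CycPairing (labSet n lab k) (row M r) (labSet n (labelRow L n M r lab) k) := by
  have hbox : ∀ d, (r, d) ∈ M → 1 ≤ d ∧ d ≤ n := by
    intro d hd
    have := hM hd
    simp only [Finset.mem_product, Finset.mem_Icc] at this
    exact this.2
  have hA := fun k hk => acquired_spec (r := r) hM hlab hcard (k := k) hk
  have hle : ∀ c, 1 ≤ c ∧ c ≤ n → acquired L n M r lab c ≤ L := by
    intro c hc
    by_contra hcon
    have h1 := (hA (L + 1) (by omega)).2
    have h2 : labSet n lab (L + 1) = ∅ := by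
      ext c
      have := hlab c
      simp only [mem_labSet, Finset.notMem_empty, iff_false]
      omega
    rw [h2, Finset.card_empty, Finset.card_eq_zero] at h1
    have : c ∈ labSet n (acquired L n M r lab) (L + 1) := mem_labSet.2 ⟨hc, by omega⟩
    rw [h1] at this
    simp at this
  have hge : ∀ c, 1 ≤ c ∧ c ≤ n → acquired L n M r lab c ≠ 0 → r + 1 ≤ acquired L n M r lab c := by
    intro c hc hne
    have h1 := (hA (r + 1) (by omega)).2
    have h2 := (hA 1 le_rfl).2
    have h3 : labSet n lab (r + 1) = labSet n lab 1 := by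
      ext c
      have := hlow c
      simp only [mem_labSet]
      omega
    rw [h3] at h1
    have h4 := Finset.eq_of_subset_of_card_le
      (labSet_anti n (acquired L n M r lab) (show 1 ≤ r + 1 by omega)) (by omega)
    have h5 : c ∈ labSet n (acquired L n M r lab) 1 := mem_labSet.2 ⟨hc, by omega⟩
    rw [← h4] at h5
    exact (mem_labSet.1 h5).2
  refine ⟨fun c => ?_, fun c hc => ?_, ?_, fun k hk => ?_⟩
  · unfold labelRow
    split_ifs with h1 h2
    · exact hrL
    · exact hle c (hbox c h1)
    · omega
  · unfold labelRow at hc ⊢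
    split_ifs at hc ⊢ with h1 h2
    · exact le_rfl
    · have := hge c (hbox c h1) h2
      omega
    · exact absurd rfl hc
  · ext c
    simp only [mem_labSet, mem_row]
    unfold labelRow
    split_ifs with h1 h2
    · simp [h1, hbox c h1, hr1]
    · simp only [h1, iff_true]
      exact ⟨hbox c h1, by omega⟩
    · simp [h1]
  · have : labSet n (labelRow L n M r lab) k = labSet n (acquired L n M r lab) k := by
      ext c
      simp only [mem_labSet]
      refine and_congr_right fun hc => ?_
      unfold labelRow
      split_ifs with h1 h2
      · omega
      · rfl
      · obtain ⟨⟨u, hu⟩, -⟩ := hA k (by omega)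
        refine ⟨fun h => by omega, fun h => ?_⟩
        exact absurd (mem_row.1 (hu.sub (mem_labSet.2 ⟨hc, h⟩))) h1
    rw [this]
    exact hA k (by omega)

theorem rowLabels_spec (hM : M ⊆ box L n)
    (hst : ∀ r, 1 ≤ r → r < L → rowCard M (r + 1) ≤ rowCard M r) (hr1 : 1 ≤ r) (hr : r ≤ L + 1) :
    (∀ c, rowLabels L n M r c ≤ L) ∧ (∀ c, rowLabels L n M r c ≠ 0 → r ≤ rowLabels L n M r c) ∧
      labSet n (rowLabels L n M r) 1 = row M r ∧
      (r ≤ L → ∀ k, r < k → CycPairing (labSet n (rowLabels L n M (r + 1)) k) (row M r)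
        (labSet n (rowLabels L n M r) k)) := by
  obtain ⟨d, hd⟩ : ∃ d, r + d = L + 1 := ⟨L + 1 - r, by omega⟩
  induction d generalizing r with
  | zero =>
    obtain rfl : r = L + 1 := by omega
    -- The empty row above the array starts the downward induction.
    have h0 : rowLabels L n M (L + 1) = fun _ => 0 := by
      unfold rowLabels
      rw [show L + 1 - (L + 1) = 0 by omega]
      rfl
    rw [h0]
    refine ⟨fun _ => Nat.zero_le _, fun _ h => absurd rfl h, ?_, fun h => by omega⟩
    ext c
    simp only [mem_labSet, mem_row]
    refine ⟨fun h => by omega, fun h => ?_⟩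
    have := hM h
    simp only [Finset.mem_product, Finset.mem_Icc] at this
    omega
  | succ d ih =>
    obtain ⟨h1, h2, h3, -⟩ := ih (r := r + 1) (by omega) (by omega) (by omega)
    have hcard : (labSet n (rowLabels L n M (r + 1)) 1).card ≤ (row M r).card := by
      rw [h3, card_row, card_row]
      rcases Nat.lt_or_ge r L with h | h
      · exact hst r hr1 h
      · obtain rfl : r = L := by omega
        have : row M (r + 1) = ∅ := by
          ext c
          simp only [mem_row, Finset.notMem_empty, iff_false]
          intro hc
          have := hM hc
          simp only [Finset.mem_product, Finset.mem_Icc] at this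
          omega
        rw [← card_row, this]
        simp
    obtain ⟨g1, g2, g3, g4⟩ := labelRow_spec hM hr1 (by omega) h1 h2 hcard
    rw [← rowLabels_of_le (by omega)] at g1 g2 g3 g4
    exact ⟨g1, g2, g3, fun _ => g4⟩

theorem labSet_rowLabels_self (hM : M ⊆ box L n)
    (hst : ∀ r, 1 ≤ r → r < L → rowCard M (r + 1) ≤ rowCard M r) (hr1 : 1 ≤ r) (hr : r ≤ L) :
    labSet n (rowLabels L n M r) r = row M r := by
  obtain ⟨-, h2, h3, -⟩ := rowLabels_spec hM hst hr1 (by omega)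
  rw [← h3]
  ext c
  have := h2 c
  simp only [mem_labSet]
  omega

/-- The columns whose entry in the type is at least `k`. -/
def typeSet (L n : ℕ) (M : Config) (k : ℕ) : Finset ℕ := labSet n (rowLabels L n M 1) k

theorem type_eq_iff {M' : Config} (hM : M ⊆ box L n) (hM' : M' ⊆ box L n)
    (hst : ∀ r, 1 ≤ r → r < L → rowCard M (r + 1) ≤ rowCard M r)
    (hst' : ∀ r, 1 ≤ r → r < L → rowCard M' (r + 1) ≤ rowCard M' r) :
    type L n M = type L n M' ↔ ∀ k, 1 ≤ k → k ≤ L → typeSet L n M k = typeSet L n M' k := by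
  have e : ∀ M : Config, rowLabels L n M 1 = labelsFromTop L n M L := fun M => by
    unfold rowLabels
    rw [show L + 1 - 1 = L by omega]
  have b1 := (rowLabels_spec hM hst le_rfl (by omega)).1
  have b2 := (rowLabels_spec hM' hst' le_rfl (by omega)).1
  unfold typeSet type
  rw [e] at *
  rw [e] at *
  constructor
  · intro h k _ _
    ext c
    simp only [mem_labSet]
    refine and_congr_right fun hc => ?_
    have := congrFun h ⟨c - 1, by omega⟩
    simp only [show c - 1 + 1 = c by omega] at this
    rw [this]
  · intro h
    funext ⟨c, hc⟩
    simp only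
    have key : ∀ k, 1 ≤ k → k ≤ L → (k ≤ labelsFromTop L n M L (c + 1) ↔
        k ≤ labelsFromTop L n M' L (c + 1)) := by
      intro k hk1 hk
      have := Finset.ext_iff.1 (h k hk1 hk) (c + 1)
      simp only [mem_labSet] at this
      omega
    have h1 := key (labelsFromTop L n M L (c + 1))
    have h2 := key (labelsFromTop L n M' L (c + 1))
    have := b1 (c + 1)
    have := b2 (c + 1)
    omega

end

section

variable {L n : ℕ} {M : Config}

/-! ### The type of a multiline queue as a bottom row -/

/-- The raising operators with index `i, i - 1, …, 1`, where the one with index `j` is applied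
`a j` times and the one with index `i` comes first. -/
noncomputable def raiseDown (n : ℕ) (a : ℕ → ℕ) : ℕ → Config → Config
  | 0, M => M
  | i + 1, M => raiseDown n a i ((fUp n (i + 1))^[a (i + 1)] M)

theorem IsVertical.raiseDown (a : ℕ → ℕ) {i : ℕ} (hi : i = 0 ∨ i < L) :
    IsVertical L n (raiseDown n a i) := by
  induction i with
  | zero => exact IsVertical.id
  | succ i ih =>
    exact (ih (by omega)).comp ((IsVertical.fUp (by omega) (by omega)).iterate (a (i + 1)))

theorem row_fUp_iterate_of_ne (M : Config) {j r : ℕ} (m : ℕ) (h1 : r ≠ j) (h2 : r ≠ j + 1) :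
    row ((fUp n j)^[m] M) r = row M r := by
  induction m with
  | zero => rfl
  | succ m ih => rw [Function.iterate_succ_apply', row_fUp_of_ne _ h1 h2, ih]

/-- The set of labels at least `k` always has as many elements as row `k`. Raising the surplus of
the next row therefore performs one cyclic pairing, which is the passage to the next level set by
uniqueness. -/
theorem row_raiseDown (hM : M ⊆ box L n)
    (hst : ∀ r, 1 ≤ r → r < L → rowCard M (r + 1) ≤ rowCard M r) {k i : ℕ} (hk : k ≤ L)
    (hi : i + 1 ≤ k) {a : ℕ → ℕ}
    (ha : ∀ j, 1 ≤ j → j ≤ i → rowCard M j = rowCard M k + a j) {W : Config} (hW : W ⊆ box L n)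
    (hrow : row W (i + 1) = labSet n (rowLabels L n M (i + 1)) k)
    (hcard : rowCard W (i + 1) = rowCard M k) (hlow : ∀ r, r ≤ i → row W r = row M r) :
    row (raiseDown n a i W) 1 = typeSet L n M k := by
  induction i generalizing W with
  | zero => exact hrow
  | succ i ih =>
    have hlow1 := hlow (i + 1) le_rfl
    have hca := ha (i + 1) (by omega) le_rfl
    obtain ⟨u, hu, hc⟩ := pairing_fUp_iterate (j := i + 1) (a := a (i + 1)) hW (by
      rw [hcard, ← card_row, hlow1, card_row, hca])
    have h1 : CycPairing (labSet n (rowLabels L n M (i + 1 + 1)) k) (row M (i + 1))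
        (row ((fUp n (i + 1))^[a (i + 1)] W) (i + 1)) := by
      rw [← hrow, ← hlow1]
      exact ⟨⟨u, hu⟩, hc⟩
    have h2 := (rowLabels_spec hM hst (show 1 ≤ i + 1 by omega) (by omega)).2.2.2 (by omega) k
      (by omega)
    refine ih (by omega) (fun j hj1 hj => ha j hj1 (by omega))
      (((IsVertical.fUp (by omega) (by omega)).iterate (a (i + 1))).subset hW) (h1.unique h2) ?_
      fun r hr => ?_
    · rw [← card_row, hc, card_row, hcard]
    · rw [row_fUp_iterate_of_ne _ _ (by omega) (by omega), hlow r (by omega)]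

/-- The `k`-th level of the type is the bottom row after moving row `k` to the bottom. -/
theorem typeSet_eq_row (hM : M ⊆ box L n)
    (hst : ∀ r, 1 ≤ r → r < L → rowCard M (r + 1) ≤ rowCard M r) {k : ℕ} (hk1 : 1 ≤ k)
    (hk : k ≤ L) :
    typeSet L n M k = row (raiseDown n (fun j => rowCard M j - rowCard M k) (k - 1) M) 1 := by
  -- This makes the truncated differences in the exponents genuine.
  have hanti : ∀ j, 1 ≤ j → j ≤ k → rowCard M k ≤ rowCard M j := by
    intro j hj1 hj
    obtain ⟨d, rfl⟩ : ∃ d, k = j + d := ⟨k - j, by omega⟩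
    clear hk1 hj
    induction d with
    | zero => exact le_rfl
    | succ d ih => exact (hst (j + d) (by omega) (by omega)).trans (ih (by omega))
  symm
  refine row_raiseDown hM hst hk (by omega) (fun j hj1 hj => ?_) hM ?_ ?_ fun _ _ => rfl
  · have := hanti j hj1 (by omega)
    omega
  · rw [show k - 1 + 1 = k by omega]
    exact (labSet_rowLabels_self hM hst hk1 hk).symm
  · rw [show k - 1 + 1 = k by omega]

/-! ### Recovering the bottom row from the type of the collapse -/

/-- The balls of `A` that are paired with balls of `P` weakly to their left. -/
noncomputable def queue (P A : Finset ℕ) : Finset ℕ :=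
  (Pairing.exists_of_nonneg P A le_rfl).choose

theorem queue_spec (P A : Finset ℕ) : Pairing P A (queue P A) 0 :=
  (Pairing.exists_of_nonneg P A le_rfl).choose_spec

/-- The balls of row `1` that are reached from the balls `P` of row `i + 1`. -/
noncomputable def pushDown (N : Config) : ℕ → Finset ℕ → Finset ℕ
  | 0, P => P
  | i + 1, P => pushDown N i (queue P (row N (i + 1)))

theorem Pairing.pushDown (N : Config) (i : ℕ) {P A C : Finset ℕ} {t : ℤ} (hPA : P ⊆ A)
    (h : Pairing P A C t) (ht : 0 ≤ t) :
    Pairing (pushDown N i P) (pushDown N i A) (pushDown N i C) t := by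
  induction i generalizing P A C with
  | zero => exact h
  | succ i ih =>
    obtain ⟨h1, h2⟩ := h.push hPA ht (queue_spec A (row N (i + 1))) (queue_spec P _)
      (queue_spec C _)
    exact ih h1 h2

theorem rowCard_le_of_lowHw (hM : M ⊆ box L n) {j : ℕ} (h : LowHw n M j) :
    rowCard M (j + 1) ≤ rowCard M j := by
  have := lowHw_iff_suf.1 h 0 (by omega)
  rw [suf_zero (row_subset hM _), suf_zero (row_subset hM _), card_row, card_row] at this
  exact_mod_cast this

/-- Without droppable balls each row dominates the one above in suffix counts, so cyclic pairing
never wraps and coincides with `queue`. -/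
theorem typeSet_eq_pushDown {N : Config} (hN : N ⊆ box L n)
    (hl : ∀ j, 1 ≤ j → j < L → LowHw n N j) {i : ℕ} (hi : i < L) :
    pushDown N i (row N (i + 1)) = typeSet L n N (i + 1) := by
  have hst : ∀ r, 1 ≤ r → r < L → rowCard N (r + 1) ≤ rowCard N r :=
    fun r h1 h2 => rowCard_le_of_lowHw hN (hl r h1 h2)
  have key : ∀ m, m ≤ i →
      pushDown N m (labSet n (rowLabels L n N (m + 1)) (i + 1)) = typeSet L n N (i + 1) := by
    intro m
    induction m with
    | zero => intro _; rfl
    | succ m ih =>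
      intro hm
      rw [MultilineQueue.pushDown]
      convert ih (by omega) using 2
      refine CycPairing.unique (P := labSet n (rowLabels L n N (m + 1 + 1)) (i + 1))
        (B := row N (m + 1)) ⟨⟨0, queue_spec _ _⟩, ?_⟩
        ((rowLabels_spec hN hst (by omega) (by omega)).2.2.2 (by omega) (i + 1) (by omega))
      refine (queue_spec _ _).card_eq (N := row N (m + 1 + 1)) (n := n) ?_ (row_subset hN _)
        (row_subset hN _) fun x hx => ?_
      · rw [← (rowLabels_spec hN hst (show 1 ≤ m + 1 + 1 by omega) (by omega)).2.2.1]
        exact labSet_anti _ _ (by omega)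
      · have := hl (m + 1) (by omega) (by omega) x hx
        unfold rowBal at this
        omega
  rw [← key i le_rfl, labSet_rowLabels_self hN hst (by omega) (by omega)]

/-- The drop of index `i + 1` fixes row `i + 1` for the rest of the sweep and exhibits the earlier
row as a pairing inside it. Pushing this relation to row `1` keeps the same `t`, which row sizes
determine. -/
theorem pairing_pushDown_upSweep {Y : Config} (hY : Y ⊆ box L n) {i : ℕ} (hi : i + 1 < L) :
    ∃ t : ℤ, (rowCard (upSweep L n i Y) (i + 1) : ℤ) =
        rowCard (upSweep L n (i + 1) Y) (i + 2) + t ∧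
      Pairing (pushDown (upSweep L n (L - 1) Y) (i + 1) (row (upSweep L n (i + 1) Y) (i + 2)))
        (pushDown (upSweep L n (L - 1) Y) i (row (upSweep L n (L - 1) Y) (i + 1)))
        (pushDown (upSweep L n (L - 1) Y) i (row (upSweep L n i Y) (i + 1))) t := by
  obtain ⟨⟨t, ht, hc, hp⟩, -⟩ := eDownStar_spec
    ((IsVertical.upSweep (L := L) (n := n) (k := i) (by omega)).subset hY)
    (show 1 ≤ i + 1 by omega) hi
  refine ⟨t, hc, ?_⟩
  rw [MultilineQueue.pushDown]
  have e : row (upSweep L n (L - 1) Y) (i + 1) = row (upSweep L n (i + 1) Y) (i + 1) :=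
    row_upSweep_of_le (by omega) (by omega) le_rfl Y
  rw [e]
  have h1 := queue_spec (row (upSweep L n (i + 1) Y) (i + 2)) (row (upSweep L n (i + 1) Y) (i + 1))
  exact (hp.self_of_subset h1 ht).pushDown _ i h1.sub ht

/-- The bottom row is determined by the type of the result of an upward sweep and the row sizes. -/
theorem row_one_eq_of_typeSet_eq {Y Y' : Config} (hL : 1 ≤ L) (hY : Y ⊆ box L n)
    (hY' : Y' ⊆ box L n) (h : ∀ j, 2 ≤ j → j < L → LowHw n Y j)
    (h' : ∀ j, 2 ≤ j → j < L → LowHw n Y' j)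
    (hcard : ∀ k < L, ∀ r, rowCard (upSweep L n k Y) r = rowCard (upSweep L n k Y') r)
    (htype : ∀ k, 1 ≤ k → k ≤ L →
      typeSet L n (upSweep L n (L - 1) Y) k = typeSet L n (upSweep L n (L - 1) Y') k) :
    row Y 1 = row Y' 1 := by
  have hS : ∀ i < L, pushDown (upSweep L n (L - 1) Y) i (row (upSweep L n (L - 1) Y) (i + 1)) =
      pushDown (upSweep L n (L - 1) Y') i (row (upSweep L n (L - 1) Y') (i + 1)) := by
    intro i hi
    rw [typeSet_eq_pushDown ((IsVertical.upSweep (by omega)).subset hY)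
        (fun j h1 h2 => lowHw_upSweep hY h h1 h2) hi,
      typeSet_eq_pushDown ((IsVertical.upSweep (by omega)).subset hY')
        (fun j h1 h2 => lowHw_upSweep hY' h' h1 h2) hi]
    exact htype (i + 1) (by omega) (by omega)
  -- Descending induction: the top level is part of the type data, each pairing recovers the next
  -- level, and `i = 0` gives the original bottom row.
  have key : ∀ d i, i + d + 1 = L →
      pushDown (upSweep L n (L - 1) Y) i (row (upSweep L n i Y) (i + 1)) =
      pushDown (upSweep L n (L - 1) Y') i (row (upSweep L n i Y') (i + 1)) := by
    intro d
    induction d with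
    | zero =>
      intro i hi
      obtain rfl : i = L - 1 := by omega
      exact hS _ (by omega)
    | succ d ih =>
      intro i hi
      obtain ⟨t, ht, hp⟩ := pairing_pushDown_upSweep (i := i) hY (by omega)
      obtain ⟨t', ht', hp'⟩ := pairing_pushDown_upSweep (i := i) hY' (by omega)
      have e : t = t' := by
        have := hcard i (by omega) (i + 1)
        have := hcard (i + 1) (by omega) (i + 2)
        omega
      have e1 := ih (i + 1) (by omega)
      rw [show i + 1 + 1 = i + 2 by rfl] at e1
      rw [e1, hS i (by omega), e] at hp
      exact hp.unique hp'
  exact key (L - 1) 0 (by omega)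

/-! ### Uniqueness of the collapse -/

theorem reach_rowCard {A B : Config} (hA : A ⊆ box L n)
    (h : Relation.ReflTransGen (fun A B => ∃ i, 1 ≤ i ∧ i < n ∧ fRight L n i A = B) A B)
    {Φ : Config → Config} (hΦ : IsVertical L n Φ) :
    B ⊆ box L n ∧ ∀ r, rowCard (Φ B) r = rowCard (Φ A) r := by
  induction h with
  | refl => exact ⟨hA, fun _ => rfl⟩
  | tail _ h ih =>
    obtain ⟨i, hi1, hi, rfl⟩ := h
    exact ⟨fRight_subset ih.1 hi1 hi, fun r => by
      rw [hΦ.comm ih.1 hi1 hi, rowCard_fRight hi1 hi, ih.2]⟩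

theorem reach_lowHw {A B : Config} (hA : A ⊆ box L n)
    (h : Relation.ReflTransGen (fun A B => ∃ i, 1 ≤ i ∧ i < n ∧ fRight L n i A = B) A B)
    {Φ : Config → Config} (hΦ : IsVertical L n Φ) {j : ℕ} (hj1 : 1 ≤ j) (hj : j < L) :
    LowHw n (Φ B) j ↔ LowHw n (Φ A) j := by
  suffices B ⊆ box L n ∧ (LowHw n (Φ B) j ↔ LowHw n (Φ A) j) from this.2
  induction h with
  | refl => exact ⟨hA, Iff.rfl⟩
  | tail _ h ih =>
    obtain ⟨i, hi1, hi, rfl⟩ := h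
    exact ⟨fRight_subset ih.1 hi1 hi, by
      rw [hΦ.comm ih.1 hi1 hi, lowHw_fRight hj1 hj hi1 hi, ih.2]⟩

/-- A vertical map that leaves no droppable balls in `M` collapses `M`. -/
theorem IsVertical.eq_collapse {Φ : Config → Config} (hΦ : IsVertical L n Φ) (hM : M ⊆ box L n)
    (h : ∀ j, 1 ≤ j → j < L → LowHw n (Φ M) j) : Φ M = MultilineQueue.collapse L n M := by
  obtain ⟨A, hA, hw, hr⟩ := exists_colHw hM
  refine hΦ.eq_of_reach IsVertical.collapse hA hr ?_
  -- At the highest weight element both images are of highest weight in both directions, and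
  -- vertical maps keep the column counts.
  refine eq_of_highest (hΦ.subset hA) (IsVertical.collapse.subset hA) (hΦ.colHw hA hw)
    (IsVertical.collapse.colHw hA hw) (fun j h1 h2 => (reach_lowHw hA hr hΦ h1 h2).1 (h j h1 h2))
    (fun j h1 h2 => lowHw_collapse hA h1 h2) fun c => ?_
  rw [hΦ.col hA, IsVertical.collapse.col hA]

/-! ### The recording tableau -/

/-- Rows do not shrink during a sweep (`rowCard_stage_le`), so the truncated number of added boxes
is the true increase. -/
theorem recordingStage_spec (hM : M ⊆ box L n) {k : ℕ} (hk : k = 0 ∨ k < L) {j : ℕ} (hj1 : 1 ≤ j)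
    (hj : j ≤ k + 1) :
    (recordingStage L n M k j).length = rowCard (stage L n M k) j ∧
      ∀ a ∈ recordingStage L n M k j, a ≤ k + 1 := by
  induction k with
  | zero =>
    obtain rfl : j = 1 := by omega
    simp [recordingStage, stage]
  | succ k ih =>
    simp only [recordingStage]
    rcases Nat.lt_or_ge j (k + 2) with h | h
    · obtain ⟨h1, h2⟩ := ih (by omega) (by omega)
      rw [if_pos ⟨hj1, h⟩, List.length_append, h1, List.length_replicate]
      have := rowCard_stage_le (n := n) (show k + 1 < L by omega) hM hj1 (by omega)
      refine ⟨by omega, fun a ha => ?_⟩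
      rcases List.mem_append.1 ha with ha | ha
      · have := h2 a ha
        omega
      · rw [List.eq_of_mem_replicate ha]
    · obtain rfl : j = k + 2 := by omega
      rw [if_neg (by omega), if_pos rfl, List.length_replicate]
      exact ⟨rfl, fun a ha => by rw [List.eq_of_mem_replicate ha]⟩

/-- Later steps append only larger entries, so the final tableau remembers every intermediate one.
-/
theorem filter_recordingStage (hM : M ⊆ box L n) {k j : ℕ} (hj1 : 1 ≤ j) (hj : j ≤ k + 1) (m : ℕ)
    (hm : k + m = 0 ∨ k + m < L) :
    (recordingStage L n M (k + m) j).filter (fun a => a ≤ k + 1) = recordingStage L n M k j := by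
  induction m with
  | zero =>
    refine List.filter_eq_self.2 fun a ha => ?_
    simpa using (recordingStage_spec hM hm hj1 hj).2 a ha
  | succ m ih =>
    rw [← add_assoc, recordingStage]
    beta_reduce
    rw [if_pos ⟨hj1, by omega⟩, List.filter_append, ih (by omega)]
    rw [List.filter_eq_nil_iff.2, List.append_nil]
    intro a ha
    rw [List.eq_of_mem_replicate ha]
    simp

theorem rowCard_stage_of_recording {M' : Config} (hM : M ⊆ box L n) (hM' : M' ⊆ box L n)
    (h : recording L n M = recording L n M') {k j : ℕ} (hk : k < L) (hj1 : 1 ≤ j)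
    (hj : j ≤ k + 1) : rowCard (stage L n M k) j = rowCard (stage L n M' k) j := by
  have e := congrFun h j
  unfold recording at e
  obtain ⟨m, hm⟩ : ∃ m, L - 1 = k + m := ⟨L - 1 - k, by omega⟩
  rw [hm] at e
  have e1 := filter_recordingStage hM hj1 hj m (by omega)
  have e2 := filter_recordingStage hM' hj1 hj m (by omega)
  rw [← (recordingStage_spec hM (by omega) hj1 hj).1, ← (recordingStage_spec hM' (by omega) hj1 hj).1,
    ← e1, ← e2, e]

theorem recording_congr {M' : Config}
    (h : ∀ k, k = 0 ∨ k < L → ∀ r, rowCard (stage L n M k) r = rowCard (stage L n M' k) r) :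
    recording L n M = recording L n M' := by
  unfold recording
  have : ∀ k, k = 0 ∨ k < L → recordingStage L n M k = recordingStage L n M' k := by
    intro k
    induction k with
    | zero =>
      intro h0
      have := h 0 h0 1
      simp only [stage] at this
      funext j
      simp only [recordingStage, this]
    | succ k ih =>
      intro hk
      funext j
      simp only [recordingStage]
      rw [ih (by omega), h (k + 1) hk, h k (by omega)]
  exact this _ (by omega)

theorem pre_col_eDownStar {j t : ℕ} (hj1 : 1 ≤ j) (hj : j < L) (ht : t ≠ j) (M : Config) (c : ℕ) :
    pre (col (eDownStar L n j M) c) t = pre (col M c) t := by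
  unfold eDownStar
  generalize M.card = k
  induction k with
  | zero => rfl
  | succ k ih => rw [Function.iterate_succ_apply', pre_col_eDown hj1 hj _ c ht, ih]

theorem pre_col_sweep {i t : ℕ} (hi : i < L) (ht : i < t) (M : Config) (c : ℕ) :
    pre (col (sweep L n i M) c) t = pre (col M c) t := by
  induction i generalizing M with
  | zero => rfl
  | succ i ih =>
    rw [sweep, ih (by omega) (by omega), pre_col_eDownStar (by omega) hi (by omega)]

/-- The first `k` sweeps move balls only within rows up to `k + 1`, so the number of balls of a
column below any level `t > k` is kept. -/
theorem pre_col_stage {k t : ℕ} (hk : k = 0 ∨ k < L) (ht : k < t) (M : Config) (c : ℕ) :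
    pre (col (stage L n M k) c) t = pre (col M c) t := by
  induction k with
  | zero => rfl
  | succ k ih => rw [stage, pre_col_sweep (by omega) ht, ih (by omega) (by omega)]

/-- A highest weight configuration is determined by the row sizes in its collapsing procedure. -/
theorem eq_of_rowCard_stage {A B : Config} (hA : A ⊆ box L n) (hB : B ⊆ box L n)
    (hwA : ColHw L n A) (hwB : ColHw L n B)
    (h : ∀ k j, k < L → 1 ≤ j → j ≤ k + 1 →
      rowCard (stage L n A k) j = rowCard (stage L n B k) j) : A = B := by
  have key : ∀ c t, t ≤ L → pre (col A c) t = pre (col B c) t := by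
    intro c t ht
    rcases t with _ | k
    · rw [pre_zero (zero_notMem_of_subset (col_subset hA c)),
        pre_zero (zero_notMem_of_subset (col_subset hB c))]
    · have hv : IsVertical L n fun M => stage L n M k := IsVertical.stage (by omega)
      rw [← pre_col_stage (L := L) (n := n) (k := k) (by omega) (by omega) A c,
        ← pre_col_stage (L := L) (n := n) (k := k) (by omega) (by omega) B c]
      -- Up to row `k + 1` both stage configurations have initial intervals as rows, and the
      -- intervals have equal lengths.
      refine pre_eq_of fun r hr => ?_
      rcases r with _ | r
      · exact iff_of_false (zero_notMem_of_subset (col_subset (hv.subset hA) c))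
          (zero_notMem_of_subset (col_subset (hv.subset hB) c))
      · rw [mem_col, mem_col, ← mem_row, ← mem_row,
          row_eq_Icc (m := k + 1) (hv.subset hA) (by omega) (hv.colHw hA hwA)
            (fun j h1 h2 => lowHw_stage (by omega) hA j h1 (by omega)) (by omega) hr,
          row_eq_Icc (m := k + 1) (hv.subset hB) (by omega) (hv.colHw hB hwB)
            (fun j h1 h2 => lowHw_stage (by omega) hB j h1 (by omega)) (by omega) hr,
          h k (r + 1) (by omega) (by omega) hr]
  ext ⟨r, c⟩
  rw [← mem_col, ← mem_col]
  have : col A c = col B c := pre_ext fun x => by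
    rcases le_total x L with hx | hx
    · exact key c x hx
    · rw [pre_eq_of_le (col_subset hA c) hx, pre_eq_of_le (col_subset hB c) hx, key c L le_rfl]
  rw [this]

end

/-! ### Components, recording tableaux and types -/

namespace MLQ

variable {lam : YoungDiagram} {n : ℕ}

theorem rowCard_anti (M : MLQ lam n) : ∀ r, 1 ≤ r → r < height lam →
    rowCard M.1 (r + 1) ≤ rowCard M.1 r := by
  intro r hr1 hr
  obtain ⟨r, rfl⟩ : ∃ k, r = k + 1 := ⟨r - 1, by omega⟩
  rw [M.2.2 (r + 1) hr, M.2.2 r (by omega)]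
  exact lam.colLen_anti r (r + 1) (by omega)

theorem sameComponent_of_reach (A : MLQ lam n) {B : Config}
    (h : Relation.ReflTransGen
      (fun A B => ∃ i, 1 ≤ i ∧ i < n ∧ fRight (height lam) n i A = B) A.1 B) :
    ∃ hB, A.SameComponent ⟨B, hB⟩ := by
  induction h with
  | refl => exact ⟨A.2, .refl _⟩
  | tail _ h ih =>
    obtain ⟨hB, hc⟩ := ih
    obtain ⟨i, hi1, hi, rfl⟩ := h
    refine ⟨⟨fRight_subset hB.1 hi1 hi, fun r hr => ?_⟩, hc.trans _ _ _ (.rel _ _ ⟨i, hi1, hi, rfl⟩)⟩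
    rw [rowCard_fRight hi1 hi, hB.2 r hr]

theorem SameComponent.recording_eq {M M' : MLQ lam n} (h : M.SameComponent M') :
    M.recording = M'.recording :=
  recording_congr fun _ hk r => (IsVertical.stage hk).rowCard_eq h r

theorem sameComponent_of_recording_eq {M M' : MLQ lam n} (h : M.recording = M'.recording) :
    M.SameComponent M' := by
  obtain ⟨A, hA, hw, hr⟩ := exists_colHw M.2.1
  obtain ⟨A', hA', hw', hr'⟩ := exists_colHw M'.2.1
  have e : A = A' := by
    refine eq_of_rowCard_stage hA hA' hw hw' fun k j hk hj1 hj => ?_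
    have hv : IsVertical (height lam) n fun M => stage (height lam) n M k :=
      IsVertical.stage (by omega)
    rw [← (reach_rowCard hA hr hv).2, ← (reach_rowCard hA' hr' hv).2]
    exact rowCard_stage_of_recording M.2.1 M'.2.1 h hk hj1 hj
  subst e
  have hmem : A ⊆ box (height lam) n ∧ ∀ r < height lam, rowCard A (r + 1) = lam.colLen r :=
    ⟨hA, fun r hr' => by
      rw [← M.2.2 r hr', (reach_rowCard hA hr IsVertical.id).2]⟩
  obtain ⟨_, h1⟩ := sameComponent_of_reach ⟨A, hmem⟩ hr
  obtain ⟨_, h2⟩ := sameComponent_of_reach ⟨A, hmem⟩ hr'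
  exact (h1.symm _ _).trans _ _ _ h2

theorem SameComponent.type_eq {M M' : MLQ lam n} (h : M.SameComponent M')
    (hc : M.collapseType = M'.collapseType) : M.type = M'.type := by
  have hcol : ∀ M : MLQ lam n, ∀ r, 1 ≤ r → r < height lam →
      rowCard (collapse (height lam) n M.1) (r + 1) ≤ rowCard (collapse (height lam) n M.1) r :=
    fun M r h1 h2 => rowCard_le_of_lowHw (IsVertical.collapse.subset M.2.1)
      (lowHw_collapse M.2.1 h1 h2)
  have hN := (type_eq_iff (IsVertical.collapse.subset M.2.1) (IsVertical.collapse.subset M'.2.1)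
    (hcol M) (hcol M')).1 hc
  refine (type_eq_iff M.2.1 M'.2.1 M.rowCard_anti M'.rowCard_anti).2 fun k hk1 hk => ?_
  rw [typeSet_eq_row M.2.1 M.rowCard_anti hk1 hk, typeSet_eq_row M'.2.1 M'.rowCard_anti hk1 hk]
  -- The exponents depend only on row sizes, so one vertical map serves both queues.
  have ea : (fun j => rowCard M'.1 j - rowCard M'.1 k) =
      fun j => rowCard M.1 j - rowCard M.1 k := by
    funext j
    rw [IsVertical.id.rowCard_eq h j, IsVertical.id.rowCard_eq h k]
  rw [ea]
  have hΨ : IsVertical (height lam) n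
      (raiseDown n (fun j => rowCard M.1 j - rowCard M.1 k) (k - 1)) :=
    IsVertical.raiseDown _ (by omega)
  generalize raiseDown n (fun j => rowCard M.1 j - rowCard M.1 k) (k - 1) = Ψ at hΨ ⊢
  obtain ⟨Φ, hΦ, hrow, hlow⟩ := exists_lowHw_above (hΨ.subset M.2.1)
  have hΘ := hΦ.comp hΨ
  have hlow' : ∀ j, 2 ≤ j → j < height lam → LowHw n (Φ (Ψ M'.1)) j := fun j h1 h2 => by
    rw [← hΘ.lowHw_iff h (by omega) h2]
    exact hlow j h1 h2
  rw [← hrow (Ψ M.1), ← hrow (Ψ M'.1)]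
  have hU : ∀ k < height lam, IsVertical (height lam) n
      fun A => upSweep (height lam) n k (Φ (Ψ A)) :=
    fun k hk => (IsVertical.upSweep (Or.inr hk)).comp hΘ
  refine row_one_eq_of_typeSet_eq (by omega) (hΘ.subset M.2.1) (hΘ.subset M'.2.1) hlow hlow'
    (fun k hk r => (hU k hk).rowCard_eq h r) ?_
  -- The whole composition is one vertical map leaving nothing to drop in either queue, so it yields
  -- both collapses.
  have hUL := hU (height lam - 1) (by omega)
  have e1 := hUL.eq_collapse M.2.1 fun j h1 h2 => lowHw_upSweep (hΘ.subset M.2.1) hlow h1 h2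
  have e2 := hUL.eq_collapse M'.2.1 fun j h1 h2 => lowHw_upSweep (hΘ.subset M'.2.1) hlow' h1 h2
  rw [e1, e2]
  exact hN

end MLQ

end MultilineQueue

theorem mainTheorem3 (lam : YoungDiagram) (n : ℕ) (M M' : MultilineQueue.MLQ lam n) :
    (M.SameComponent M' ↔ M.recording = M'.recording) ∧
      (M.SameComponent M' → M.collapseType = M'.collapseType → M.type = M'.type) :=
  ⟨⟨fun h => h.recording_eq, MultilineQueue.MLQ.sameComponent_of_recording_eq⟩,
    fun h hc => h.type_eq hc⟩
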